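/- Let $q$ be an indeterminate and, for $m\in\mathbb{Z}$, let $[m]=(q^m-q^{-m})/(q-q^{-1})\in\mathbb{C}(q)$. Let $\mathcal{TL}_n$ be the Temperley–Lieb algebra of type $A$ on $n$ strands, i.e. the unital associative $\mathbb{C}(q)$-algebra with generators $e_1,\dots,e_{n-1}$ and relations $e_i^2=-[2]e_i$, $e_ie_{i+1}e_i=e_i$, $e_{i+1}e_ie_{i+1}=e_{i+1}$, and $e_ie_j=e_je_i$ for $|i-j|>1$. Its elements are expanded as linear combinations of $n$-strand Temperley–Lieb diagrams (non-crossing perfect matchings of $n$ bottom and $n$ top points): $e_i$ is the diagram with a cap joining the bottom points $i,i+1$, a cup joining the top points $i,i+1$, and vertical strands elsewhere; in a product $D_1D_2$ the diagram $D_1$ is placed on top of $D_2$, and each closed loop is removed with a factor $-[2]$. **Theorem.** There is exactly one element $P^{(n)}\in\mathcal{TL}_n$ (the Jones–Wenzl projection) with $P^{(n)}\neq0$, $P^{(n)}P^{(n)}=P^{(n)}$ and $e_iP^{(n)}=P^{(n)}e_i=0$ for all $i$. For every $n$-strand Temperley–Lieb diagram $D$, the coefficient of $D$ in $P^{(n)}$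 is $$Z(\mu)=\sum_{T\in\mathcal{D}(\mu)}\ \prod_{d\in T}\frac{[h(d)]}{[h(d)+1]},$$ where $\mu$ is the Dyck path of $D$ and the right-hand side is defined as follows. * Read the bottom points of $D$ from left to right and then its top points from right to left; write an up step $U=(1,1)$ for each point that is the first end of its arc in this order, and a down step $R=(1,-1)$ for each point that is the second end. The resulting path from $(0,0)$ to $(2n,0)$ is $\mu$. * The region between $\mu$ and $U^nR^n$ consists of unit boxes, the squares with corners $(x\pm1,y)$, $(x,y\pm1)$ and center $(x,y)$, where $x+y$ is odd. A Dyck tile is a set of boxes whose centers are the lattice points of a translate of a Dyck path (possibly of size $0$, i.e. a single box). A Dyck tiling is a partition of the region into Dyck tiles. It is cover-inclusive if each of its tiles, translated by $(0,-2)$, is either strictly below $\mu$ or contained in another tile of the tiling. $\mathcal{D}(\mu)$ is the set of cover-inclusive Dyck tilings of the region above $\mu$ and below $U^nR^n$. * $h(d)$ is the smallest height ($y$-coordinate) of the centers of the boxes of the tile $d$. -/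

import Mathlib

namespace JonesWenzl

noncomputable section

/-! ### Quantum integers -/

/-- The field `ℂ(q)`. -/
abbrev K : Type := RatFunc ℂ

/-- The indeterminate `q`. -/
def q : K := RatFunc.X

/-- The quantum integer `[m] = (q^m - q^(-m)) / (q - q^(-1))`. -/
def qInt (m : ℤ) : K := (q ^ m - q ^ (-m)) / (q - q⁻¹)

/-! ### The Temperley--Lieb algebra of type A -/

/-- The defining relations of the Temperley--Lieb algebra on `n` strands. The index `i : Fin (n - 1)`
stands for the generator attached to the (zero-based) positions `i` and `i + 1`. -/
inductive TLRel (n : ℕ) :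
    FreeAlgebra K (Fin (n - 1)) → FreeAlgebra K (Fin (n - 1)) → Prop
  | sq (i : Fin (n - 1)) :
      TLRel n (FreeAlgebra.ι K i * FreeAlgebra.ι K i) (-(qInt 2) • FreeAlgebra.ι K i)
  | up (i j : Fin (n - 1)) (h : j.val = i.val + 1) :
      TLRel n (FreeAlgebra.ι K i * FreeAlgebra.ι K j * FreeAlgebra.ι K i) (FreeAlgebra.ι K i)
  | down (i j : Fin (n - 1)) (h : j.val = i.val + 1) :
      TLRel n (FreeAlgebra.ι K j * FreeAlgebra.ι K i * FreeAlgebra.ι K j) (FreeAlgebra.ι K j)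
  | comm (i j : Fin (n - 1)) (h : i.val + 1 < j.val ∨ j.val + 1 < i.val) :
      TLRel n (FreeAlgebra.ι K i * FreeAlgebra.ι K j) (FreeAlgebra.ι K j * FreeAlgebra.ι K i)

/-- The Temperley--Lieb algebra `TL_n` of type A, by generators and relations. -/
abbrev TLAlgebra (n : ℕ) : Type := RingQuot (TLRel n)

/-- The generator `e_i` of `TL_n`. -/
def e {n : ℕ} (i : Fin (n - 1)) : TLAlgebra n :=
  RingQuot.mkAlgHom K (TLRel n) (FreeAlgebra.ι K i)

/-- The properties that characterize the Jones--Wenzl projection `P^(n)`. -/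
def IsJonesWenzl {n : ℕ} (P : TLAlgebra n) : Prop :=
  P ≠ 0 ∧ P * P = P ∧ ∀ i : Fin (n - 1), e i * P = 0 ∧ P * e i = 0

/-! ### Temperley--Lieb diagrams -/

/-- The marked points of an `n` strand diagram: `inl j` is the `j`-th point from the left at the
bottom, `inr j` is the `j`-th point from the left at the top (counted from `0`). -/
abbrev Pt (n : ℕ) : Type := Fin n ⊕ Fin n

/-- The position of a marked point after the diagram is folded down to the right: first the bottom
points from left to right, then the top points from right to left. This is also the order of the
marked points along the boundary of the diagram. -/
def fold {n : ℕ} : Pt n → ℕ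
  | Sum.inl j => j.val
  | Sum.inr j => 2 * n - 1 - j.val

/-- The marked point at a given position of the folded diagram. -/
def unfold {n : ℕ} (k : Fin (2 * n)) : Pt n :=
  if h : k.val < n then Sum.inl ⟨k.val, h⟩ else Sum.inr ⟨2 * n - 1 - k.val, by omega⟩

lemma fold_lt {n : ℕ} (x : Pt n) : fold x < 2 * n := by
  rcases x with j | j <;> simp only [fold] <;> omega

lemma fold_injective {n : ℕ} : Function.Injective (fold (n := n)) := by
  rintro (⟨i, hi⟩ | ⟨i, hi⟩) (⟨j, hj⟩ | ⟨j, hj⟩) h <;> simp [fold] at h ⊢ <;> omega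

lemma fold_unfold {n : ℕ} (k : Fin (2 * n)) : fold (unfold k) = k.val := by
  unfold unfold
  split_ifs with h
  · rfl
  · simp only [fold]; omega

lemma unfold_fold {n : ℕ} (x : Pt n) : unfold ⟨fold x, fold_lt x⟩ = x :=
  fold_injective (fold_unfold _)

/-- An `n` strand Temperley--Lieb diagram up to isotopy: a perfect matching of the `2n` marked
points (`partner x` is the other end of the arc at `x`) whose arcs do not intersect. -/
@[ext]
structure TLDiagram (n : ℕ) where
  partner : Pt n → Pt n
  partner_partner : ∀ x, partner (partner x) = x
  partner_ne : ∀ x, partner x ≠ x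
  noncrossing : ∀ x y, ¬ (fold x < fold y ∧ fold y < fold (partner x) ∧
    fold (partner x) < fold (partner y))

/-- The identity diagram: `n` vertical strands. -/
def idDiagram (n : ℕ) : TLDiagram n where
  partner := Sum.swap
  partner_partner := Sum.swap_swap
  partner_ne := by rintro (x | x) <;> simp
  noncrossing := by
    rintro (x | x) (y | y) <;>
      simp only [fold, Sum.swap_inl, Sum.swap_inr] <;> omega

/-- Put a cup joining `p` and `p'` above a matching `σ`: the points `p` and `p'` are
joined with each other, and so are their former partners. -/
def reconnect {X : Type} [DecidableEq X] (p p' : X) (σ : X → X) (x : X) : X :=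
  if x = p then p' else if x = p' then p
  else if x = σ p then σ p' else if x = σ p' then σ p else σ x

section reconnect

variable {X : Type} [DecidableEq X] {σ : X → X}

lemma reconnect_invol (h2 : ∀ x, σ (σ x) = x) (hne : ∀ x, σ x ≠ x) (p p' : X) (x : X) :
    reconnect p p' σ (reconnect p p' σ x) = x := by
  obtain ⟨y, hy⟩ : ∃ y, y = reconnect p p' σ x := ⟨_, rfl⟩
  rw [← hy]
  unfold reconnect at hy ⊢
  have := h2 p; have := h2 p'; have := h2 x
  have := hne p; have := hne p'; have := hne x
  grind

lemma reconnect_ne (h2 : ∀ x, σ (σ x) = x) (hne : ∀ x, σ x ≠ x) {p p' : X} (hp : p ≠ p') (x : X) :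
    reconnect p p' σ x ≠ x := by
  unfold reconnect
  have := h2 p; have := h2 p'; have := h2 x; have := hne x
  grind

lemma reconnect_sq {p p' : X} : reconnect p p' (reconnect p p' σ) = reconnect p p' σ := by
  funext x
  unfold reconnect
  grind

lemma reconnect_braid (h2 : ∀ x, σ (σ x) = x) {a b c : X} (hab : a ≠ b)
    (hbc : b ≠ c) (hac : a ≠ c) :
    reconnect a b (reconnect b c (reconnect a b σ)) = reconnect a b σ := by
  funext x
  unfold reconnect
  have := h2 a; have := h2 b; have := h2 c; have := h2 x
  grind

lemma reconnect_symm {a b : X} (hab : a ≠ b) (h2 : ∀ x, σ (σ x) = x) :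
    reconnect a b σ = reconnect b a σ := by
  funext x
  unfold reconnect
  have := h2 a; have := h2 b
  grind

lemma reconnect_comm (h2 : ∀ x, σ (σ x) = x) (hne : ∀ x, σ x ≠ x) {a b c d : X} (hab : a ≠ b)
    (hcd : c ≠ d) (hac : a ≠ c) (had : a ≠ d) (hbc : b ≠ c) (hbd : b ≠ d) :
    reconnect a b (reconnect c d σ) = reconnect c d (reconnect a b σ) := by
  obtain ⟨τ, hτ⟩ : ∃ τ, τ = reconnect c d σ := ⟨_, rfl⟩
  obtain ⟨ρ, hρ⟩ : ∃ ρ, ρ = reconnect a b σ := ⟨_, rfl⟩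
  funext x
  have h1 := congrFun hτ a; have h3 := congrFun hτ b; have h4 := congrFun hτ x
  have h5 := congrFun hρ c; have h6 := congrFun hρ d; have h7 := congrFun hρ x
  rw [← hτ, ← hρ]
  unfold reconnect at h1 h3 h4 h5 h6 h7 ⊢
  have := h2 a; have := h2 b; have := h2 c; have := h2 d; have := h2 x
  have := hne a; have := hne b; have := hne c; have := hne d; have := hne x
  clear hτ hρ
  grind (splits := 30)

lemma reconnect_loop_iff (h2 : ∀ x, σ (σ x) = x) (hne : ∀ x, σ x ≠ x) {a b c d : X}
    (hcd : c ≠ d) (hac : a ≠ c) (had : a ≠ d) (hbc : b ≠ c) (hbd : b ≠ d) :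
    reconnect c d σ a = b ↔ σ a = b ∨ (σ a = c ∧ σ b = d) ∨ (σ a = d ∧ σ b = c) := by
  unfold reconnect
  have := h2 a; have := h2 b; have := h2 c; have := h2 d
  have := hne a; have := hne b; have := hne c; have := hne d
  grind (splits := 30)

lemma reconnect_noncrossing (h2 : ∀ x, σ (σ x) = x) {f : X → ℕ}
    (hf : Function.Injective f)
    (hnc : ∀ x y, ¬ (f x < f y ∧ f y < f (σ x) ∧ f (σ x) < f (σ y)))
    {p p' : X} (hp : f p = f p' + 1) (x y : X) :
    ¬ (f x < f y ∧ f y < f (reconnect p p' σ x) ∧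
      f (reconnect p p' σ x) < f (reconnect p p' σ y)) := by
  have hin : ∀ x y, f x < f y → f y < f (σ x) → f x < f (σ y) ∧ f (σ y) < f (σ x) := by
    intro x y h3 h4
    have h5 := hnc x y
    have h6 := hnc (σ y) x
    have h7 := h2 y
    have h8 : f (σ y) ≠ f (σ x) := fun h => by
      have := congrArg σ (hf h); rw [h2, h2] at this; subst this; omega
    have h9 : f (σ y) ≠ f x := fun h => by
      have := hf h; rw [← this, h2] at h4; omega
    rw [h7] at h6
    omega
  clear hnc
  have inj : ∀ x y, x ≠ y → f x ≠ f y := fun x y h h' => h (hf h')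
  have hp1 := h2 p
  have hp2 := h2 p'
  rintro ⟨k1, k2, k3⟩
  by_cases e1 : x = p
  · simp only [reconnect, e1, if_true] at k1 k2; omega
  by_cases e2 : x = p'
  · have : p' ≠ p := fun h => e1 (e2.trans h)
    simp only [reconnect, e2, this, if_true, if_false] at k1 k2; omega
  by_cases f1 : y = p
  · rw [show reconnect p p' σ y = p' by simp [reconnect, f1]] at k3
    rw [f1] at k1 k2; omega
  by_cases f2 : y = p'
  · have : p' ≠ p := fun h => f1 (f2.trans h)
    rw [show reconnect p p' σ y = p by simp [reconnect, f2, this]] at k3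
    rw [f2] at k1 k2; omega
  have i1 := inj x p e1
  have i2 := inj x p' e2
  have i3 := inj y p f1
  have i4 := inj y p' f2
  by_cases e3 : x = σ p
  · have hu : reconnect p p' σ x = σ p' := by simp only [reconnect, e1, e2, if_false, if_pos e3]
    have f3 : y ≠ σ p := fun h => by rw [h, e3] at k1; omega
    have f4 : y ≠ σ p' := fun h => by rw [h, hu] at k2; omega
    have hv : reconnect p p' σ y = σ y := by simp only [reconnect, f1, f2, f3, f4, if_false]
    rw [hu] at k2 k3; rw [hv] at k3; rw [e3] at k1 i1 i2
    have c1 := hin p y; have c2 := hin (σ p) y; have c3 := hin p' y; have c4 := hin (σ p') y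
    have c5 := hin p (σ y); have c6 := hin (σ p) (σ y)
    have c7 := hin p' (σ y); have c8 := hin (σ p') (σ y)
    simp only [h2] at c2 c4 c5 c6 c7 c8
    have j1 : f (σ y) ≠ f p := fun h => f3 (by rw [← hf h, h2])
    have j2 : f (σ y) ≠ f p' := fun h => f4 (by rw [← hf h, h2])
    omega
  by_cases e4 : x = σ p'
  · have hu : reconnect p p' σ x = σ p := by
      simp only [reconnect, e1, e2, e3, if_false, if_pos e4]
    have f3 : y ≠ σ p := fun h => by rw [h, hu] at k2; omega
    have f4 : y ≠ σ p' := fun h => by rw [h, e4] at k1; omega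
    have hv : reconnect p p' σ y = σ y := by simp only [reconnect, f1, f2, f3, f4, if_false]
    rw [hu] at k2 k3; rw [hv] at k3; rw [e4] at k1 i1 i2
    have c1 := hin p y; have c2 := hin (σ p) y; have c3 := hin p' y; have c4 := hin (σ p') y
    have c5 := hin p (σ y); have c6 := hin (σ p) (σ y)
    have c7 := hin p' (σ y); have c8 := hin (σ p') (σ y)
    simp only [h2] at c2 c4 c5 c6 c7 c8
    have j1 : f (σ y) ≠ f p := fun h => f3 (by rw [← hf h, h2])
    have j2 : f (σ y) ≠ f p' := fun h => f4 (by rw [← hf h, h2])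
    omega
  have hu : reconnect p p' σ x = σ x := by simp only [reconnect, e1, e2, e3, e4, if_false]
  rw [hu] at k2 k3
  have j1 : f (σ x) ≠ f p := fun h => e3 (by rw [← hf h, h2])
  have j2 : f (σ x) ≠ f p' := fun h => e4 (by rw [← hf h, h2])
  by_cases f3 : y = σ p
  · have hv : reconnect p p' σ y = σ p' := by simp only [reconnect, f1, f2, if_false, if_pos f3]
    rw [hv] at k3; rw [f3] at k1 k2
    have c1 := hin x (σ p) k1 k2
    have c2 := hin x p'
    rw [h2] at c1
    omega
  by_cases f4 : y = σ p'
  · have hv : reconnect p p' σ y = σ p := by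
      simp only [reconnect, f1, f2, f3, if_false, if_pos f4]
    rw [hv] at k3; rw [f4] at k1 k2
    have c1 := hin x (σ p') k1 k2
    have c2 := hin x p
    rw [h2] at c1
    omega
  have hv : reconnect p p' σ y = σ y := by simp only [reconnect, f1, f2, f3, f4, if_false]
  rw [hv] at k3
  have := hin x y k1 k2
  omega

end reconnect

/-- The left one of the two top points at which the generator `e_i` acts. -/
def topL {n : ℕ} (i : Fin (n - 1)) : Pt n := Sum.inr ⟨i.val, by omega⟩

/-- The right one of the two top points at which the generator `e_i` acts. -/
def topR {n : ℕ} (i : Fin (n - 1)) : Pt n := Sum.inr ⟨i.val + 1, by omega⟩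

lemma topL_ne_topR {n : ℕ} (i : Fin (n - 1)) : topL i ≠ topR i := by
  simp [topL, topR]

/-- The diagram obtained by placing the diagram of `e_i` on top of `D`, without the closed loop
which appears if `D` joins the two top points `i` and `i + 1`. -/
def stack {n : ℕ} (i : Fin (n - 1)) (D : TLDiagram n) : TLDiagram n where
  partner := reconnect (topL i) (topR i) D.partner
  partner_partner := reconnect_invol D.partner_partner D.partner_ne _ _
  partner_ne := reconnect_ne D.partner_partner D.partner_ne (topL_ne_topR i)
  noncrossing := reconnect_noncrossing D.partner_partner fold_injective D.noncrossing
    (by simp only [topL, topR, fold]; omega)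

/-- Left multiplication by `e_i` on linear combinations of diagrams: `D` is sent to the diagram
`stack i D`, with a factor `-[2]` if a closed loop was removed. -/
def stackLin {n : ℕ} (i : Fin (n - 1)) : Module.End K (TLDiagram n →₀ K) :=
  Finsupp.linearCombination K fun D : TLDiagram n =>
    Finsupp.single (stack i D) (if D.partner (topL i) = topR i then -(qInt 2) else 1)

lemma stack_loop {n : ℕ} (i : Fin (n - 1)) (D : TLDiagram n) :
    (stack i D).partner (topL i) = topR i := by
  simp [stack, reconnect]

lemma stack_sq {n : ℕ} (i : Fin (n - 1)) (D : TLDiagram n) : stack i (stack i D) = stack i D := by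
  ext1
  exact reconnect_sq

lemma stackLin_single {n : ℕ} (i : Fin (n - 1)) (D : TLDiagram n) (c : K) :
    stackLin i (Finsupp.single D c) = Finsupp.single (stack i D)
      (c * if D.partner (topL i) = topR i then -(qInt 2) else 1) := by
  simp only [stackLin, Finsupp.linearCombination_single, Finsupp.smul_single, smul_eq_mul]

lemma stackLin_rel {n : ℕ} ⦃x y : FreeAlgebra K (Fin (n - 1))⦄ (h : TLRel n x y) :
    FreeAlgebra.lift K (stackLin (n := n)) x = FreeAlgebra.lift K (stackLin (n := n)) y := by
  induction h with
  | sq i =>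
    rw [map_mul, map_smul, FreeAlgebra.lift_ι_apply]
    refine Finsupp.lhom_ext fun D c => ?_
    rw [Module.End.mul_apply, LinearMap.smul_apply, stackLin_single, stackLin_single, stack_sq,
      if_pos (stack_loop i D), Finsupp.smul_single, smul_eq_mul, mul_comm (-qInt 2)]
  | up i j h =>
    rw [map_mul, map_mul, FreeAlgebra.lift_ι_apply, FreeAlgebra.lift_ι_apply]
    refine Finsupp.lhom_ext fun D c => ?_
    have hij : topR i = topL j := by simp [topL, topR, h]
    have hL : topL i ≠ topR j := by simp [topL, topR]; omega
    rw [Module.End.mul_apply, Module.End.mul_apply, stackLin_single, stackLin_single,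
      stackLin_single]
    have h1 : (stack i D).partner (topL j) = topL i := by
      rw [← hij, ← stack_loop i D, TLDiagram.partner_partner]
    have h3 : (stack j (stack i D)).partner (topR i) = topR j := by
      rw [hij]; exact stack_loop j _
    have h4 : (stack j (stack i D)).partner (topL i) ≠ topR i := by
      intro h5
      rw [← h5, TLDiagram.partner_partner] at h3
      exact hL h3
    rw [if_neg (show (stack i D).partner (topL j) ≠ topR j by rw [h1]; exact hL), if_neg h4,
      mul_one, mul_one]
    congr 1
    ext1
    change reconnect (topL i) (topR i) (reconnect (topL j) (topR j)
      (reconnect (topL i) (topR i) D.partner)) = reconnect (topL i) (topR i) D.partner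
    rw [← hij]
    exact reconnect_braid D.partner_partner (topL_ne_topR i) (hij ▸ topL_ne_topR j) hL
  | down i j h =>
    rw [map_mul, map_mul, FreeAlgebra.lift_ι_apply, FreeAlgebra.lift_ι_apply]
    refine Finsupp.lhom_ext fun D c => ?_
    have hij : topR i = topL j := by simp [topL, topR, h]
    have hL : topL i ≠ topR j := by simp [topL, topR]; omega
    rw [Module.End.mul_apply, Module.End.mul_apply, stackLin_single, stackLin_single,
      stackLin_single]
    have h1 : (stack j D).partner (topR i) = topR j := by
      rw [hij]; exact stack_loop j D
    have h2 : (stack j D).partner (topL i) ≠ topR i := by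
      intro h5
      rw [← h5, TLDiagram.partner_partner] at h1
      exact hL h1
    have h4 : (stack i (stack j D)).partner (topL j) ≠ topR j := by
      rw [← hij, ← stack_loop i, TLDiagram.partner_partner]
      exact hL
    rw [if_neg h2, if_neg h4, mul_one, mul_one]
    congr 1
    ext1
    change reconnect (topL j) (topR j) (reconnect (topL i) (topR i)
      (reconnect (topL j) (topR j) D.partner)) = reconnect (topL j) (topR j) D.partner
    have hji : topR j ≠ topL j := (topL_ne_topR j).symm
    rw [hij, reconnect_symm (topL_ne_topR j) D.partner_partner,
      reconnect_symm (σ := reconnect (topR j) (topL j) D.partner) (a := topL i)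
        (fun h => topL_ne_topR i (h.trans hij.symm))
        (reconnect_invol D.partner_partner D.partner_ne _ _),
      reconnect_symm (topL_ne_topR j)
        (reconnect_invol (reconnect_invol D.partner_partner D.partner_ne _ _)
          (reconnect_ne D.partner_partner D.partner_ne hji) _ _)]
    exact reconnect_braid D.partner_partner hji
      (fun h => topL_ne_topR i (h.symm.trans hij.symm)) hL.symm
  | comm i j h =>
    rw [map_mul, map_mul, FreeAlgebra.lift_ι_apply, FreeAlgebra.lift_ι_apply]
    refine Finsupp.lhom_ext fun D c => ?_
    have hac : topL i ≠ topL j := by simp [topL]; omega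
    have had : topL i ≠ topR j := by simp [topL, topR]; omega
    have hbc : topR i ≠ topL j := by simp [topL, topR]; omega
    have hbd : topR i ≠ topR j := by simp [topR]; omega
    rw [Module.End.mul_apply, Module.End.mul_apply, stackLin_single, stackLin_single,
      stackLin_single, stackLin_single]
    have hs : stack i (stack j D) = stack j (stack i D) := by
      ext1
      exact reconnect_comm D.partner_partner D.partner_ne (topL_ne_topR i) (topL_ne_topR j)
        hac had hbc hbd
    rw [hs, mul_assoc, mul_assoc]
    congr 2
    have h1 : (stack j D).partner (topL i) = topR i ↔
        D.partner (topL i) = topR i ∨ (D.partner (topL i) = topL j ∧ D.partner (topR i) = topR j) ∨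
          (D.partner (topL i) = topR j ∧ D.partner (topR i) = topL j) :=
      reconnect_loop_iff D.partner_partner D.partner_ne (topL_ne_topR j)
        hac had hbc hbd
    have h2 : (stack i D).partner (topL j) = topR j ↔
        D.partner (topL j) = topR j ∨ (D.partner (topL j) = topL i ∧ D.partner (topR j) = topR i) ∨
          (D.partner (topL j) = topR i ∧ D.partner (topR j) = topL i) :=
      reconnect_loop_iff D.partner_partner D.partner_ne (topL_ne_topR i)
        hac.symm hbc.symm had.symm hbd.symm
    have k1 := D.partner_partner (topL i)
    have k2 := D.partner_partner (topR i)
    have k3 := D.partner_partner (topL j)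
    have k4 := D.partner_partner (topR j)
    grind

/-- The diagrammatic representation of `TL_n`: the generator `e_i` acts on diagrams by being
placed on top. -/
def diagramRep (n : ℕ) : TLAlgebra n →ₐ[K] Module.End K (TLDiagram n →₀ K) :=
  RingQuot.liftAlgHom K ⟨FreeAlgebra.lift K stackLin, stackLin_rel⟩

/-- The expansion of an element of `TL_n` as a linear combination of diagrams. A product of
generators is expanded by stacking their diagrams, i.e. by letting the generators act successively
on the identity diagram. -/
def toDiagrams {n : ℕ} (x : TLAlgebra n) : TLDiagram n →₀ K :=
  diagramRep n x (Finsupp.single (idDiagram n) 1)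

/-- The coefficient of the diagram `D` in `x`. -/
def coeff {n : ℕ} (D : TLDiagram n) (x : TLAlgebra n) : K := toDiagrams x D

/-! ### The Dyck path of a diagram -/

/-- The position joined by an arc to the position `k` in the folded diagram. -/
def opp {n : ℕ} (D : TLDiagram n) (k : Fin (2 * n)) : Fin (2 * n) :=
  ⟨fold (D.partner (unfold k)), fold_lt _⟩

lemma opp_opp {n : ℕ} (D : TLDiagram n) : Function.Involutive (opp D) := by
  intro k
  ext
  simp only [opp]
  rw [unfold_fold, D.partner_partner, fold_unfold]

lemma opp_ne {n : ℕ} (D : TLDiagram n) (k : Fin (2 * n)) : opp D k ≠ k := by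
  intro h
  apply D.partner_ne (unfold k)
  apply fold_injective
  rw [fold_unfold]
  exact congrArg Fin.val h

/-- The letter of the folded diagram at the position `k`: the left end of an arc is an up step, the
right end of an arc is a down step. -/
def stepAt {n : ℕ} (D : TLDiagram n) (k : Fin (2 * n)) : DyckStep :=
  if k < opp D k then DyckStep.U else DyckStep.D

lemma stepAt_eq_U {n : ℕ} (D : TLDiagram n) (k : Fin (2 * n)) :
    stepAt D k = DyckStep.U ↔ k < opp D k := by
  simp [stepAt]

lemma stepAt_eq_D {n : ℕ} (D : TLDiagram n) (k : Fin (2 * n)) :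
    stepAt D k = DyckStep.D ↔ opp D k < k := by
  have := opp_ne D k
  simp only [stepAt, ite_eq_right_iff, reduceCtorEq, imp_false, not_lt]
  exact ⟨fun h => lt_of_le_of_ne h this, le_of_lt⟩

/-- The word of the folded diagram, read from left to right. -/
def diagramSteps {n : ℕ} (D : TLDiagram n) : List DyckStep := List.ofFn (stepAt D)

lemma count_take_ofFn {m : ℕ} (f : Fin m → DyckStep) (s : DyckStep) (i : ℕ) :
    ((List.ofFn f).take i).count s =
      (Finset.univ.filter fun k : Fin m => k.val < i ∧ f k = s).card := by
  induction m generalizing i with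
  | zero => simp
  | succ m ih =>
    cases i with
    | zero => simp
    | succ i =>
      rw [List.ofFn_succ, List.take_succ_cons, List.count_cons, ih, Fin.card_filter_univ_succ']
      simp [add_comm]

lemma count_take_diagramSteps {n : ℕ} (D : TLDiagram n) (s : DyckStep) (i : ℕ) :
    ((diagramSteps D).take i).count s =
      (Finset.univ.filter fun k : Fin (2 * n) => k.val < i ∧ stepAt D k = s).card :=
  count_take_ofFn _ _ _

lemma diagramSteps_nonneg {n : ℕ} (D : TLDiagram n) (i : ℕ) :
    ((diagramSteps D).take i).count DyckStep.D ≤ ((diagramSteps D).take i).count DyckStep.U := by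
  rw [count_take_diagramSteps, count_take_diagramSteps]
  refine Finset.card_le_card_of_injOn (opp D) (fun k hk => ?_) ((opp_opp D).injective.injOn)
  simp only [Finset.coe_filter, Finset.mem_univ, true_and, Set.mem_ofPred_eq, stepAt_eq_U,
    stepAt_eq_D] at hk ⊢
  rw [opp_opp D k]
  exact ⟨lt_trans (Fin.lt_def.mp hk.2) hk.1, hk.2⟩

lemma diagramSteps_balanced {n : ℕ} (D : TLDiagram n) :
    (diagramSteps D).count DyckStep.U = (diagramSteps D).count DyckStep.D := by
  have h : (diagramSteps D).take (2 * n) = diagramSteps D :=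
    List.take_of_length_le (by simp [diagramSteps])
  rw [← h, count_take_diagramSteps, count_take_diagramSteps]
  refine Finset.card_nbij' (opp D) (opp D) ?_ ?_ (fun k _ => opp_opp D k) (fun k _ => opp_opp D k)
  · intro k hk
    simp only [Finset.coe_filter, Finset.mem_univ, true_and, Set.mem_ofPred_eq, stepAt_eq_U,
      stepAt_eq_D] at hk ⊢
    rw [opp_opp D k]
    exact ⟨(opp D k).isLt, hk.2⟩
  · intro k hk
    simp only [Finset.coe_filter, Finset.mem_univ, true_and, Set.mem_ofPred_eq, stepAt_eq_U,
      stepAt_eq_D] at hk ⊢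
    rw [opp_opp D k]
    exact ⟨(opp D k).isLt, hk.2⟩

/-- The Dyck path corresponding to a Temperley--Lieb diagram. -/
def dyckPath {n : ℕ} (D : TLDiagram n) : DyckWord :=
  ⟨diagramSteps D, diagramSteps_balanced D, diagramSteps_nonneg D⟩

lemma semilength_dyckPath {n : ℕ} (D : TLDiagram n) : (dyckPath D).semilength = n := by
  have h := (dyckPath D).two_mul_semilength_eq_length
  have h' : (dyckPath D).toList.length = 2 * n := by simp [dyckPath, diagramSteps]
  omega

/-! ### Dyck tilings -/

/-- The height after `k` steps of the lattice path that starts at height `0`, with up steps `(1, 1)`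
and down steps `(1, -1)`. -/
def height (w : List DyckStep) (k : ℕ) : ℤ :=
  ((w.take k).count DyckStep.U : ℤ) - ((w.take k).count DyckStep.D : ℤ)

/-- The steps `U^n D^n` of the top Dyck path. -/
def topSteps (n : ℕ) : List DyckStep :=
  List.replicate n DyckStep.U ++ List.replicate n DyckStep.D

/-- A unit box, given by its center `(x, y)`. Its corners are the points `(x ± 1, y)` and
`(x, y ± 1)` of the lattice of all `(a, b)` with `a + b` even, so that `x + y` is odd. -/
abbrev Box : Type := ℕ × ℤ

/-- The boxes of the region above the Dyck path `μ` and below the top Dyck path of the same size. -/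
def region (μ : DyckWord) : Finset Box :=
  (Finset.range (2 * μ.semilength + 1) ×ˢ Finset.Icc (0 : ℤ) μ.semilength).filter fun s =>
    Odd ((s.1 : ℤ) + s.2) ∧ height μ.toList s.1 ≤ s.2 - 1 ∧
      s.2 + 1 ≤ height (topSteps μ.semilength) s.1

/-- A Dyck tile: the boxes whose centers are the lattice points of a translated Dyck path. -/
def IsDyckTile (d : Finset Box) : Prop :=
  ∃ (s : Box) (v : DyckWord),
    d = (Finset.range (2 * v.semilength + 1)).image fun k => (s.1 + k, s.2 + height v.toList k)

/-- A set partition of the region above `μ` is a Dyck tiling if its parts are Dyck tiles. -/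
def IsDyckTiling {μ : DyckWord} (T : Finpartition (region μ)) : Prop :=
  ∀ d ∈ T.parts, IsDyckTile d

/-- A tile translated by `(0, -2)`. -/
def shiftDown (d : Finset Box) : Finset Box := d.image fun s => (s.1, s.2 - 2)

/-- A tiling is cover-inclusive if each of its tiles, translated by `(0, -2)`, lies strictly below
`μ` or is contained in another tile. -/
def IsCoverInclusive {μ : DyckWord} (T : Finpartition (region μ)) : Prop :=
  ∀ d ∈ T.parts, (∀ s ∈ shiftDown d, s.2 < height μ.toList s.1) ∨
    ∃ t ∈ T.parts, t ≠ d ∧ shiftDown d ⊆ t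

open Classical in
/-- The set of cover-inclusive Dyck tilings above `μ`. -/
def coverInclusiveDyckTilings (μ : DyckWord) : Finset (Finpartition (region μ)) :=
  Finset.univ.filter fun T => IsDyckTiling T ∧ IsCoverInclusive T

/-- The height of a tile: the least height of the centers of its boxes. -/
def tileHeight (d : Finset Box) : ℤ := sInf (Prod.snd '' (d : Set Box))

/-- The generating function of the cover-inclusive Dyck tilings above `μ`. -/
def Z (μ : DyckWord) : K :=
  ∑ T ∈ coverInclusiveDyckTilings μ, ∏ d ∈ T.parts,
    qInt (tileHeight d) / qInt (tileHeight d + 1)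

end

end JonesWenzl

/-!
The projection exists by the Wenzl recursion inside `TL_n` (`wenzl_spec`), and it is unique because
every element acts on a vector killed by all the generators through the augmentation `e_i ↦ 0`
(`mul_eq_aug_smul`).

The same principle, applied to the diagrammatic representation, computes the coefficients. Suppose
that a combination `ζ` of diagrams is killed by all the generators and has coefficient `1` at the
identity. Then `P • ζ = ζ`. On the other hand, `P` kills every diagram `D` other than the identity,
because `D` has a cup between two neighbouring top points; so `P • ζ` is `P` applied to the identity
diagram, which is the expansion of `P`. Hence it is enough to exhibit such a `ζ`.

Let `c_j` be the operator which inserts a small arc into a folded diagram so that it joins the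
top points `j` and `j + 1` of the new diagram (and for `j = n` is a vertical strand on the right).
Put `ζ_{n+1} = ∑_{j ≤ n} [j+1]/[n+1] c_j ζ_n` (`zeta`). The relations `e_i c_i = -[2] c_i`,
`e_i c_{i±1} = c_i`, and the fact that the other `c_j` commute with the generators up to a shift of
the index, reduce the equation `e_i ζ_{n+1} = 0` to the three term recursion
`[2] [m] = [m-1] + [m+1]` (`stackLin_zeta`).

It remains to see that `Z` satisfies the same recursion. In terms of Dyck paths, `c_j` inserts a
peak after `p = 2n - j` steps, in the right half of the path. A cover-inclusive tiling above the
small path becomes one above the large path: every tile is widened by a peak where it meets the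
column `p` (`widen`, a preimage under the map `collapse` of boxes), and the strip of boxes at the
heights `n, …, j + 1` along the right side of the triangle `U^(n+1) D^(n+1)` is filled with single
boxes, with weight `∏ [h]/[h+1] = [j+1]/[n+1]`. Every tiling above the large path arises exactly
once in this way: `j` is determined by the length of the run of single boxes along the right side,
and cover-inclusiveness forces all the tiles in the column where the run ends to have a peak there
(`IsTilingSet.mem_of_mem_apex`).
-/

namespace JonesWenzl

noncomputable section

/-! ### Quantum integers are nonzero -/

lemma q_ne_zero : q ≠ 0 := RatFunc.X_ne_zero

lemma q_pow_ne_one {m : ℕ} (hm : m ≠ 0) : q ^ m ≠ 1 := by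
  intro h
  have h1 : algebraMap (Polynomial ℂ) K (Polynomial.X ^ m) = algebraMap (Polynomial ℂ) K 1 := by
    rw [map_pow, RatFunc.algebraMap_X, map_one]
    exact h
  have h2 := congrArg Polynomial.natDegree (RatFunc.algebraMap_injective ℂ h1)
  rw [Polynomial.natDegree_X_pow, Polynomial.natDegree_one] at h2
  exact hm h2

lemma q_zpow_sub_ne_zero {m : ℕ} (hm : m ≠ 0) : q ^ (m : ℤ) - q ^ (-(m : ℤ)) ≠ 0 := by
  intro h
  apply q_pow_ne_one (m := m + m) (by omega)
  have h1 : q ^ (m : ℤ) = q ^ (-(m : ℤ)) := sub_eq_zero.mp h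
  rw [zpow_neg, zpow_natCast] at h1
  rw [pow_add]
  nth_rewrite 1 [h1]
  exact inv_mul_cancel₀ (pow_ne_zero _ q_ne_zero)

lemma qInt_natCast_ne_zero {m : ℕ} (hm : m ≠ 0) : qInt (m : ℤ) ≠ 0 := by
  refine div_ne_zero (q_zpow_sub_ne_zero hm) ?_
  simpa using q_zpow_sub_ne_zero one_ne_zero

lemma qInt_pos_ne_zero {m : ℤ} (hm : 0 < m) : qInt m ≠ 0 := by
  lift m to ℕ using hm.le
  exact qInt_natCast_ne_zero (by omega)

@[simp] lemma qInt_zero : qInt 0 = 0 := by simp [qInt]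

@[simp] lemma qInt_one : qInt 1 = 1 := by
  have h := q_zpow_sub_ne_zero one_ne_zero
  simp only [qInt]
  simpa using h

/-- The three term recursion of the quantum integers. -/
lemma qInt_two_mul (m : ℤ) : qInt 2 * qInt m = qInt (m - 1) + qInt (m + 1) := by
  have h := q_zpow_sub_ne_zero one_ne_zero
  have hq := q_ne_zero
  simp only [Nat.cast_one, zpow_one, zpow_neg] at h
  have hm : q ^ m ≠ 0 := zpow_ne_zero _ hq
  simp only [qInt, neg_sub, neg_add, zpow_sub₀ hq, zpow_add₀ hq, zpow_neg, zpow_one,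
    show (2 : ℤ) = 1 + 1 from rfl]
  rw [div_mul_div_comm, ← add_div, div_eq_div_iff (mul_ne_zero h h) h]
  field_simp
  ring

/-! ### The augmentation and the uniqueness of the projection -/

/-- The augmentation of `TL_n`: the one-dimensional representation in which all generators act
by zero. -/
def aug (n : ℕ) : TLAlgebra n →ₐ[K] K :=
  RingQuot.liftAlgHom K ⟨FreeAlgebra.lift K fun _ => 0, by
    intro x y h
    induction h <;> simp⟩

@[simp] lemma aug_e {n : ℕ} (i : Fin (n - 1)) : aug n (e i) = 0 := by
  simp [aug, e]

lemma diagramRep_e {n : ℕ} (i : Fin (n - 1)) : diagramRep n (e i) = stackLin i := by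
  simp [diagramRep, e]


/-- To prove a property of all elements of `TL_n` that is closed under sums and products, it
suffices to check the scalars and the generators. -/
lemma TLAlgebra.induction {n : ℕ} {C : TLAlgebra n → Prop}
    (algebraMap : ∀ r : K, C (algebraMap K _ r)) (gen : ∀ i, C (e i))
    (mul : ∀ x y, C x → C y → C (x * y)) (add : ∀ x y, C x → C y → C (x + y))
    (x : TLAlgebra n) : C x := by
  obtain ⟨y, rfl⟩ := RingQuot.mkAlgHom_surjective K (TLRel n) x
  induction y using FreeAlgebra.induction with
  | grade0 r => rw [AlgHom.commutes]; exact algebraMap r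
  | grade1 i => exact gen i
  | mul a b ha hb => rw [map_mul]; exact mul _ _ ha hb
  | add a b ha hb => rw [map_add]; exact add _ _ ha hb

/-- Every element of `TL_n` acts by left multiplication on an element killed by the generators
through the augmentation. -/
lemma mul_eq_aug_smul {n : ℕ} {y : TLAlgebra n} (hy : ∀ i, e i * y = 0) (x : TLAlgebra n) :
    x * y = aug n x • y := by
  induction x using TLAlgebra.induction with
  | algebraMap r => rw [AlgHom.commutes, Algebra.smul_def]; rfl
  | gen i => rw [hy, aug_e, zero_smul]
  | mul a b ha hb => rw [mul_assoc, hb, mul_smul_comm, ha, map_mul, smul_smul, mul_comm]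
  | add a b ha hb => rw [add_mul, ha, hb, map_add, add_smul]

lemma mul_eq_aug_smul' {n : ℕ} {y : TLAlgebra n} (hy : ∀ i, y * e i = 0) (x : TLAlgebra n) :
    y * x = aug n x • y := by
  induction x using TLAlgebra.induction with
  | algebraMap r => rw [AlgHom.commutes, Algebra.smul_def, Algebra.commutes]; rfl
  | gen i => rw [hy, aug_e, zero_smul]
  | mul a b ha hb => rw [← mul_assoc, ha, smul_mul_assoc, hb, map_mul, smul_smul]
  | add a b ha hb => rw [mul_add, ha, hb, map_add, add_smul]

/-- `TL_n` acts through the augmentation on every combination of diagrams that is killed by the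
generators. -/
lemma diagramRep_eq_aug_smul {n : ℕ} {ζ : TLDiagram n →₀ K} (hζ : ∀ i, stackLin i ζ = 0)
    (x : TLAlgebra n) : diagramRep n x ζ = aug n x • ζ := by
  induction x using TLAlgebra.induction with
  | algebraMap r => rw [AlgHom.commutes, AlgHom.commutes]; rfl
  | gen i => rw [diagramRep_e, hζ, aug_e, zero_smul]
  | mul a b ha hb =>
    rw [map_mul, Module.End.mul_apply, hb, map_smul, ha, map_mul, smul_smul, mul_comm]
  | add a b ha hb => rw [map_add, LinearMap.add_apply, ha, hb, map_add, add_smul]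

lemma IsJonesWenzl.aug_eq_one {n : ℕ} {P : TLAlgebra n} (hP : IsJonesWenzl P) : aug n P = 1 := by
  have h := mul_eq_aug_smul (fun i => (hP.2.2 i).1) P
  rw [hP.2.1] at h
  exact (smul_left_injective K hP.1 (by simpa using h)).symm

lemma IsJonesWenzl.unique {n : ℕ} {P Q : TLAlgebra n} (hP : IsJonesWenzl P)
    (hQ : IsJonesWenzl Q) : P = Q := by
  have h1 := mul_eq_aug_smul (fun i => (hQ.2.2 i).1) P
  have h2 := mul_eq_aug_smul' (fun i => (hP.2.2 i).2) Q
  rw [hP.aug_eq_one, one_smul] at h1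
  rw [hQ.aug_eq_one, one_smul] at h2
  exact h2.symm.trans h1

/-! ### Existence of the projection: the Wenzl recursion -/

lemma e_sq {n : ℕ} (i : Fin (n - 1)) : e i * e i = -(qInt 2) • e i := by
  have h := RingQuot.mkAlgHom_rel K (TLRel.sq i)
  rwa [map_mul, map_smul] at h

lemma e_down {n : ℕ} (i j : Fin (n - 1)) (h : j.val = i.val + 1) : e j * e i * e j = e j := by
  have h := RingQuot.mkAlgHom_rel K (TLRel.down i j h)
  rwa [map_mul, map_mul] at h

lemma e_comm {n : ℕ} (i j : Fin (n - 1)) (h : i.val + 1 < j.val) : Commute (e i) (e j) := by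
  have h := RingQuot.mkAlgHom_rel K (TLRel.comm i j (Or.inl h))
  rwa [map_mul, map_mul] at h

/-- The generators of `TL_n` indexed by all natural numbers, with value `0` out of range. -/
def gen (n k : ℕ) : TLAlgebra n := if h : k < n - 1 then e ⟨k, h⟩ else 0

lemma gen_eq {n k : ℕ} (h : k < n - 1) : gen n k = e ⟨k, h⟩ := dif_pos h

lemma gen_sq (n k : ℕ) : gen n k * gen n k = -(qInt 2) • gen n k := by
  unfold gen
  split_ifs with h
  · exact e_sq _
  · simp

lemma gen_down {n k : ℕ} (h : k + 1 < n - 1) :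
    gen n (k + 1) * gen n k * gen n (k + 1) = gen n (k + 1) := by
  rw [gen_eq h, gen_eq (by omega : k < n - 1)]
  exact e_down _ _ rfl

lemma gen_comm {n j k : ℕ} (h : j + 1 < k) : Commute (gen n j) (gen n k) := by
  unfold gen
  split_ifs
  · exact e_comm _ _ h
  all_goals simp

/-- The Jones--Wenzl projection on the first `k + 1` of `n` strands, by the Wenzl recursion. -/
def wenzl (n : ℕ) : ℕ → TLAlgebra n
  | 0 => 1
  | k + 1 => wenzl n k +
      (qInt ((k + 1 : ℕ) : ℤ) / qInt ((k + 2 : ℕ) : ℤ)) • (wenzl n k * gen n k * wenzl n k)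

lemma wenzl_commute {n k j : ℕ} (h : k < j) : Commute (wenzl n k) (gen n j) := by
  induction k with
  | zero => exact Commute.one_left _
  | succ k ih =>
    have h1 := ih (by omega)
    exact h1.add_left (((h1.mul_left (gen_comm (by omega))).mul_left h1).smul_left _)

/-- The inductive package of the Wenzl recursion: the element `wenzl n k` is an idempotent killed
by the first `k` generators, and the partial trace relation holds. -/
lemma wenzl_spec {n k : ℕ} (h : k < n) :
    wenzl n k * wenzl n k = wenzl n k ∧
    (∀ j < k, gen n j * wenzl n k = 0 ∧ wenzl n k * gen n j = 0) ∧
    gen n k * wenzl n k * gen n k * wenzl n k =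
      -(qInt ((k + 2 : ℕ) : ℤ) / qInt ((k + 1 : ℕ) : ℤ)) • (gen n k * wenzl n k) ∧
    wenzl n k * gen n k * wenzl n k * gen n k =
      -(qInt ((k + 2 : ℕ) : ℤ) / qInt ((k + 1 : ℕ) : ℤ)) • (wenzl n k * gen n k) := by
  induction k with
  | zero =>
    refine ⟨one_mul _, fun j hj => absurd hj (by omega), ?_, ?_⟩ <;> simp [wenzl, gen_sq]
  | succ k ih =>
    obtain ⟨h1, h2, h3, h4⟩ := ih (by omega)
    set p := wenzl n k with hp
    set c : K := qInt ((k + 1 : ℕ) : ℤ) / qInt ((k + 2 : ℕ) : ℤ) with hc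
    have n1 : qInt ((k + 1 : ℕ) : ℤ) ≠ 0 := qInt_natCast_ne_zero (by omega)
    have n2 : qInt ((k + 2 : ℕ) : ℤ) ≠ 0 := qInt_natCast_ne_zero (by omega)
    have hcc : c * -(qInt ((k + 2 : ℕ) : ℤ) / qInt ((k + 1 : ℕ) : ℤ)) = -1 := by
      rw [hc]; field_simp
    have hw : wenzl n (k + 1) = p + c • (p * gen n k * p) := rfl
    set p' := wenzl n (k + 1)
    have hpp' : p * p' = p' := by
      rw [hw, mul_add, mul_smul_comm, ← mul_assoc, ← mul_assoc, h1]
    have hp'p : p' * p = p' := by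
      rw [hw, add_mul, smul_mul_assoc, mul_assoc _ p p, h1]
    have hk : gen n k * p' = 0 := by
      rw [hw, mul_add, mul_smul_comm, ← mul_assoc, ← mul_assoc, h3, smul_smul, hcc, neg_one_smul,
        add_neg_cancel]
    have hk' : p' * gen n k = 0 := by
      rw [hw, add_mul, smul_mul_assoc, h4, smul_smul, hcc, neg_one_smul, add_neg_cancel]
    have hcomm : Commute p (gen n (k + 1)) := wenzl_commute (by omega)
    -- the partial trace of the projection on `k + 2` strands
    have htr : gen n (k + 1) * p' * gen n (k + 1) =
        -(qInt ((k + 1 + 2 : ℕ) : ℤ) / qInt ((k + 1 + 1 : ℕ) : ℤ)) • (p * gen n (k + 1)) := by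
      by_cases hkn : k + 1 < n - 1
      · have e1 : gen n (k + 1) * p * gen n (k + 1) = -(qInt 2) • (p * gen n (k + 1)) := by
          rw [← hcomm.eq, mul_assoc, gen_sq, mul_smul_comm]
        have e2 : gen n (k + 1) * (p * gen n k * p) * gen n (k + 1) = p * gen n (k + 1) := by
          calc gen n (k + 1) * (p * gen n k * p) * gen n (k + 1)
              = (gen n (k + 1) * p) * gen n k * (p * gen n (k + 1)) := by
                simp only [mul_assoc]
            _ = p * (gen n (k + 1) * gen n k * gen n (k + 1)) * p := by
                rw [hcomm.eq]
                simp only [mul_assoc]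
                rw [← mul_assoc (gen n (k + 1)) p, ← hcomm.eq, mul_assoc]
            _ = p * gen n (k + 1) := by
                rw [gen_down hkn, mul_assoc, ← hcomm.eq, ← mul_assoc, h1]
        rw [hw, mul_add, add_mul, mul_smul_comm, smul_mul_assoc, e1, e2, ← add_smul]
        congr 1
        have h5 := qInt_two_mul ((k + 2 : ℕ) : ℤ)
        rw [show ((k + 2 : ℕ) : ℤ) - 1 = ((k + 1 : ℕ) : ℤ) by push_cast; ring,
          show ((k + 2 : ℕ) : ℤ) + 1 = ((k + 1 + 2 : ℕ) : ℤ) by push_cast; ring] at h5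
        rw [hc, show k + 1 + 1 = k + 2 from rfl]
        field_simp
        linear_combination -h5
      · have : gen n (k + 1) = 0 := dif_neg hkn
        simp [this]
    refine ⟨?_, fun j hj => ?_, ?_, ?_⟩
    · nth_rewrite 1 [hw]
      rw [add_mul, hpp', smul_mul_assoc, mul_assoc, hpp', mul_assoc, hk, mul_zero, smul_zero,
        add_zero]
    · rcases Nat.lt_succ_iff_lt_or_eq.mp hj with hj | rfl
      · rw [← hpp', ← mul_assoc, (h2 j hj).1, zero_mul, hpp', ← hp'p, mul_assoc, (h2 j hj).2,
          mul_zero]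
        exact ⟨rfl, rfl⟩
      · exact ⟨hk, hk'⟩
    · rw [htr, smul_mul_assoc, hcomm.eq, mul_assoc, hpp']
    · rw [mul_assoc p', mul_assoc p', htr, mul_smul_comm, ← mul_assoc, hp'p]

lemma aug_gen (n k : ℕ) : aug n (gen n k) = 0 := by
  unfold gen
  split_ifs <;> simp

lemma aug_wenzl (n k : ℕ) : aug n (wenzl n k) = 1 := by
  induction k with
  | zero => exact map_one _
  | succ k ih => simp [wenzl, ih, aug_gen]

lemma exists_isJonesWenzl (n : ℕ) : ∃ P : TLAlgebra n, IsJonesWenzl P := by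
  -- `n - 1` truncates to `0` for `n = 0`, where `wenzl 0 0 = 1` is the projection
  refine ⟨wenzl n (n - 1), fun h => ?_, ?_, fun i => ?_⟩
  · have := aug_wenzl n (n - 1)
    rw [h, map_zero] at this
    exact zero_ne_one this
  · rcases n with _ | n
    · exact one_mul _
    · exact (wenzl_spec (by omega)).1
  · have := (wenzl_spec (n := n) (k := n - 1) (by have := i.isLt; omega)).2.1 i i.isLt
    rwa [gen_eq i.isLt] at this

/-! ### Diagrams as matchings of positions -/

/-- The matching of a diagram on the positions of the folded diagram, extended by the identity to
all natural numbers. -/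
def pos {n : ℕ} (D : TLDiagram n) (k : ℕ) : ℕ :=
  if h : k < 2 * n then (opp D ⟨k, h⟩).val else k

section pos

variable {n : ℕ} (D : TLDiagram n)

lemma pos_lt {k : ℕ} (h : k < 2 * n) : pos D k < 2 * n := by
  rw [pos, dif_pos h]; exact (opp D ⟨k, h⟩).isLt

lemma pos_of_le {k : ℕ} (h : 2 * n ≤ k) : pos D k = k := dif_neg (by omega)

lemma pos_val (k : Fin (2 * n)) : pos D k = opp D k := dif_pos k.isLt

lemma pos_pos (k : ℕ) : pos D (pos D k) = k := by
  by_cases h : k < 2 * n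
  · rw [pos, dif_pos (pos_lt D h)]
    have : (⟨pos D k, pos_lt D h⟩ : Fin (2 * n)) = opp D ⟨k, h⟩ := Fin.ext (pos_val D ⟨k, h⟩)
    rw [this, opp_opp D]
  · rw [pos_of_le D (not_lt.mp h), pos_of_le D (not_lt.mp h)]

lemma pos_ne {k : ℕ} (h : k < 2 * n) : pos D k ≠ k := by
  rw [pos, dif_pos h]
  exact fun h' => opp_ne D ⟨k, h⟩ (Fin.ext h')

lemma pos_injective : Function.Injective (pos D) := Function.LeftInverse.injective (pos_pos D)

lemma pos_fold (x : Pt n) : pos D (fold x) = fold (D.partner x) := by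
  rw [pos, dif_pos (fold_lt x), opp]
  simp only [unfold_fold]

lemma pos_noncrossing (a b : ℕ) : ¬ (a < b ∧ b < pos D a ∧ pos D a < pos D b) := by
  rintro ⟨h1, h2, h3⟩
  have ha : a < 2 * n := by
    by_contra h
    rw [pos_of_le D (by omega)] at h2; omega
  have hb : b < 2 * n := h2.trans (pos_lt D ha)
  have ea := fold_unfold (⟨a, ha⟩ : Fin (2 * n))
  have eb := fold_unfold (⟨b, hb⟩ : Fin (2 * n))
  simp only at ea eb
  apply D.noncrossing (unfold ⟨a, ha⟩) (unfold ⟨b, hb⟩)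
  rw [← pos_fold, ← pos_fold, ea, eb]
  exact ⟨h1, h2, h3⟩

end pos

lemma pos_inj {n : ℕ} {D E : TLDiagram n} (h : pos D = pos E) : D = E := by
  ext1
  funext x
  apply fold_injective
  rw [← pos_fold, ← pos_fold, h]

/-- The diagram with a given matching of positions. -/
def ofPos {n : ℕ} (F : ℕ → ℕ) (hlt : ∀ k < 2 * n, F k < 2 * n) (hinv : ∀ k, F (F k) = k)
    (hne : ∀ k < 2 * n, F k ≠ k) (hnc : ∀ a b, ¬ (a < b ∧ b < F a ∧ F a < F b)) :
    TLDiagram n where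
  partner x := unfold ⟨F (fold x), hlt _ (fold_lt x)⟩
  partner_partner x := by
    apply fold_injective
    rw [fold_unfold]
    simp only [fold_unfold, hinv]
  partner_ne x h := by
    have := congrArg fold h
    rw [fold_unfold] at this
    exact hne _ (fold_lt x) this
  noncrossing x y := by
    rw [fold_unfold, fold_unfold]
    exact hnc _ _

lemma pos_ofPos {n : ℕ} {F : ℕ → ℕ} (hlt : ∀ k < 2 * n, F k < 2 * n) (hinv : ∀ k, F (F k) = k)
    (hne : ∀ k < 2 * n, F k ≠ k) (hnc : ∀ a b, ¬ (a < b ∧ b < F a ∧ F a < F b)) {k : ℕ}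
    (hk : k < 2 * n) : pos (ofPos F hlt hinv hne hnc) k = F k := by
  have h := pos_fold (ofPos F hlt hinv hne hnc) (unfold ⟨k, hk⟩)
  rw [fold_unfold] at h
  rw [h]
  simp only [ofPos, fold_unfold]

lemma pos_idDiagram {n k : ℕ} (hk : k < 2 * n) : pos (idDiagram n) k = 2 * n - 1 - k := by
  have h := pos_fold (idDiagram n) (unfold ⟨k, hk⟩)
  rw [fold_unfold] at h
  rw [h]
  unfold unfold
  split_ifs with h1
  · simp [idDiagram, fold]
  · simp [idDiagram, fold]

/-- Putting a cup on top commutes with an injective relabelling of the points. -/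
lemma reconnect_map {X Y : Type} [DecidableEq X] [DecidableEq Y] {f : X → Y}
    (hf : Function.Injective f) {σ : X → X} {τ : Y → Y} (h : ∀ x, τ (f x) = f (σ x)) (a b x : X) :
    reconnect (f a) (f b) τ (f x) = f (reconnect a b σ x) := by
  simp only [reconnect, h, hf.eq_iff]
  split_ifs <;> rfl

/-- The points outside the arcs touched by a cup keep their partners. -/
lemma reconnect_of_ne {X : Type} [DecidableEq X] {σ : X → X} {a b x : X} (h1 : x ≠ a) (h2 : x ≠ b)
    (h3 : x ≠ σ a) (h4 : x ≠ σ b) : reconnect a b σ x = σ x := by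
  simp [reconnect, h1, h2, h3, h4]

lemma fold_topL {n : ℕ} (i : Fin (n - 1)) : fold (topL i) = 2 * n - 1 - i := rfl

lemma fold_topR {n : ℕ} (i : Fin (n - 1)) : fold (topR i) = 2 * n - 2 - i := by
  simp only [fold, topR]; omega

lemma pos_stack {n : ℕ} (i : Fin (n - 1)) (D : TLDiagram n) :
    pos (stack i D) = reconnect (2 * n - 1 - i) (2 * n - 2 - i) (pos D) := by
  funext k
  by_cases hk : k < 2 * n
  · have h := pos_fold (stack i D) (unfold ⟨k, hk⟩)
    have h2 := reconnect_map fold_injective (pos_fold D) (topL i) (topR i) (unfold ⟨k, hk⟩)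
    rw [fold_unfold, fold_topL, fold_topR] at h2
    rw [fold_unfold] at h
    rw [h, h2]
    rfl
  · have hi := i.isLt
    rw [pos_of_le _ (by omega), reconnect_of_ne, pos_of_le _ (by omega)]
    · omega
    · omega
    · have := pos_lt D (show 2 * n - 1 - i < 2 * n by omega); omega
    · have := pos_lt D (show 2 * n - 2 - i < 2 * n by omega); omega

lemma partner_topL_iff {n : ℕ} (i : Fin (n - 1)) (D : TLDiagram n) :
    D.partner (topL i) = topR i ↔ pos D (2 * n - 1 - i) = 2 * n - 2 - i := by
  rw [← fold_topL, ← fold_topR, pos_fold, fold_injective.eq_iff]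

/-! ### Insertion of a small arc -/

/-- The order embedding of the positions that leaves a gap at `p` and `p + 1`. -/
def gap (p k : ℕ) : ℕ := if k < p then k else k + 2

lemma gap_injective (p : ℕ) : Function.Injective (gap p) := by
  intro a b h
  simp only [gap] at h
  split_ifs at h <;> omega

lemma gap_lt_gap {p a b : ℕ} : gap p a < gap p b ↔ a < b := by
  simp only [gap]
  split_ifs <;> omega

lemma gap_ne (p k : ℕ) : gap p k ≠ p ∧ gap p k ≠ p + 1 := by
  simp only [gap]
  split_ifs <;> omega

lemma exists_gap_eq {p k : ℕ} (h1 : k ≠ p) (h2 : k ≠ p + 1) : ∃ j, k = gap p j := by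
  by_cases h : k < p
  · exact ⟨k, by simp [gap, h]⟩
  · exact ⟨k - 2, by simp only [gap]; split_ifs <;> omega⟩

/-- The insertion of an arc joining the new positions `p` and `p + 1` into a matching. -/
def insertArc (p : ℕ) (F : ℕ → ℕ) (k : ℕ) : ℕ :=
  if k < p then gap p (F k) else if k = p then p + 1 else if k = p + 1 then p
  else gap p (F (k - 2))

section insertArc

variable (p : ℕ) (F : ℕ → ℕ)

@[simp] lemma insertArc_self : insertArc p F p = p + 1 := by simp [insertArc]

@[simp] lemma insertArc_succ : insertArc p F (p + 1) = p := by simp [insertArc]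

lemma insertArc_gap (k : ℕ) : insertArc p F (gap p k) = gap p (F k) := by
  unfold insertArc
  by_cases h : k < p
  · simp [gap, h]
  · have e : gap p k = k + 2 := if_neg h
    rw [e, if_neg (by omega), if_neg (by omega), if_neg (by omega), Nat.add_sub_cancel]

lemma insertArc_injective : Function.Injective (insertArc p) := by
  intro F G h
  funext k
  have := congrFun h (gap p k)
  rw [insertArc_gap, insertArc_gap] at this
  exact gap_injective p this

variable {F}

lemma insertArc_invol (hF : ∀ k, F (F k) = k) (k : ℕ) : insertArc p F (insertArc p F k) = k := by
  by_cases h1 : k = p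
  · simp [h1]
  by_cases h2 : k = p + 1
  · simp [h2]
  obtain ⟨j, rfl⟩ := exists_gap_eq h1 h2
  rw [insertArc_gap, insertArc_gap, hF]

lemma insertArc_noncrossing
    (hnc : ∀ a b, ¬ (a < b ∧ b < F a ∧ F a < F b)) (a b : ℕ) :
    ¬ (a < b ∧ b < insertArc p F a ∧ insertArc p F a < insertArc p F b) := by
  rintro ⟨h1, h2, h3⟩
  by_cases a1 : a = p
  · rw [a1, insertArc_self] at h2; omega
  by_cases a2 : a = p + 1
  · rw [a2, insertArc_succ] at h2; omega
  obtain ⟨i, rfl⟩ := exists_gap_eq a1 a2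
  have := gap_ne p (F i)
  rw [insertArc_gap] at h2 h3
  by_cases b1 : b = p
  · rw [b1, insertArc_self] at h3; omega
  by_cases b2 : b = p + 1
  · rw [b2, insertArc_succ] at h3; omega
  obtain ⟨j, rfl⟩ := exists_gap_eq b1 b2
  rw [insertArc_gap] at h3
  rw [gap_lt_gap] at h1 h2 h3
  exact hnc i j ⟨h1, h2, h3⟩

/-- A cup placed away from the inserted arc can be placed before the insertion. -/
lemma reconnect_insertArc_of_ne (a b : ℕ) :
    reconnect (gap p a) (gap p b) (insertArc p F) = insertArc p (reconnect a b F) := by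
  funext x
  have ha := gap_ne p a
  have hb := gap_ne p b
  have hFa := gap_ne p (F a)
  have hFb := gap_ne p (F b)
  by_cases h1 : x = p
  · subst h1
    rw [reconnect_of_ne ha.1.symm hb.1.symm (by rw [insertArc_gap]; exact hFa.1.symm)
      (by rw [insertArc_gap]; exact hFb.1.symm), insertArc_self, insertArc_self]
  by_cases h2 : x = p + 1
  · subst h2
    rw [reconnect_of_ne ha.2.symm hb.2.symm (by rw [insertArc_gap]; exact hFa.2.symm)
      (by rw [insertArc_gap]; exact hFb.2.symm), insertArc_succ, insertArc_succ]
  obtain ⟨j, rfl⟩ := exists_gap_eq h1 h2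
  rw [reconnect_map (gap_injective p) (insertArc_gap p F), insertArc_gap]

/-- A cup that straddles the right end of the inserted arc straightens it. -/
lemma reconnect_insertArc_left (hF : ∀ k, F (F k) = k) (hne : F p ≠ p) :
    reconnect (p + 2) (p + 1) (insertArc p F) = insertArc (p + 1) F := by
  funext x
  have hinj : ∀ a b, F a = b → a = F b := fun a b h => by rw [← h, hF]
  have e : insertArc p F (p + 2) = gap p (F p) := by
    rw [← insertArc_gap]; simp [gap]
  simp only [reconnect, e, insertArc_succ]
  have h1 := hinj x p
  have h2 := hinj (x - 2) p
  have h3 := hF p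
  simp only [insertArc, gap]
  grind

/-- A cup that straddles the left end of the inserted arc straightens it. -/
lemma reconnect_insertArc_right (hF : ∀ k, F (F k) = k) (hne : F p ≠ p) :
    reconnect (p + 1) p (insertArc (p + 1) F) = insertArc p F := by
  funext x
  have hinj : ∀ a b, F a = b → a = F b := fun a b h => by rw [← h, hF]
  have e : insertArc (p + 1) F p = gap (p + 1) (F p) := by
    rw [← insertArc_gap]; simp [gap]
  simp only [reconnect, e, insertArc_self]
  have h1 := hinj x p
  have h2 := hinj (x - 2) p
  have h3 := hF p
  simp only [insertArc, gap]
  grind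

end insertArc

/-- The insertion of a small arc into a diagram, at the folded positions `2 * n - j` and
`2 * n - j + 1`. For `j < n` the arc joins the top points `j` and `j + 1` of the new diagram; for
`j = n` it is a vertical strand to the right of the old diagram. -/
def ins {n : ℕ} (j : ℕ) (D : TLDiagram n) : TLDiagram (n + 1) :=
  ofPos (insertArc (2 * n - j) (pos D))
    (fun k hk => by
      have h1 : k < 2 * n → pos D k < 2 * n := pos_lt D
      have h2 : k - 2 < 2 * n → pos D (k - 2) < 2 * n := pos_lt D
      simp only [insertArc, gap]
      split_ifs <;> omega)
    (insertArc_invol _ (pos_pos D))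
    (fun k hk => by
      have h1 : k < 2 * n → pos D k ≠ k := pos_ne D
      have h2 : k - 2 < 2 * n → pos D (k - 2) ≠ k - 2 := pos_ne D
      simp only [insertArc, gap]
      split_ifs <;> omega)
    (insertArc_noncrossing _ (pos_noncrossing D))

lemma pos_ins {n : ℕ} (j : ℕ) (D : TLDiagram n) :
    pos (ins j D) = insertArc (2 * n - j) (pos D) := by
  funext k
  by_cases hk : k < 2 * (n + 1)
  · exact pos_ofPos _ _ _ _ hk
  · rw [pos_of_le _ (not_lt.mp hk)]
    have h2 : pos D (k - 2) = k - 2 := pos_of_le D (by omega)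
    simp only [insertArc, gap, h2]
    split_ifs <;> omega

lemma ins_injective {n : ℕ} (j : ℕ) : Function.Injective (ins (n := n) j) := by
  intro D E h
  apply pos_inj
  apply insertArc_injective (2 * n - j)
  rw [← pos_ins, ← pos_ins, h]

/-! ### The generators and the insertion of arcs -/

section stack_ins

variable {n : ℕ} (D : TLDiagram n)

lemma stack_of_loop (i : Fin (n - 1)) (h : D.partner (topL i) = topR i) : stack i D = D := by
  ext1
  funext x
  have h' : D.partner (topR i) = topL i := by rw [← h, D.partner_partner]
  simp only [stack, reconnect, h, h']
  split_ifs with h1 h2 <;> simp_all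

lemma partner_ins_self (i : Fin (n + 1 - 1)) : (ins i D).partner (topL i) = topR i := by
  have hi := i.isLt
  rw [partner_topL_iff, pos_ins, show 2 * (n + 1) - 1 - (i : ℕ) = 2 * n - i + 1 by omega,
    show 2 * (n + 1) - 2 - (i : ℕ) = 2 * n - i by omega, insertArc_succ]

lemma stack_ins_left (i : Fin (n + 1 - 1)) : stack i (ins (i + 1) D) = ins i D := by
  have hi := i.isLt
  apply pos_inj
  obtain ⟨p, hp⟩ : ∃ p, p = 2 * n - (i + 1) := ⟨_, rfl⟩
  rw [pos_stack, pos_ins, pos_ins, ← hp, show 2 * (n + 1) - 1 - (i : ℕ) = p + 2 by omega,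
    show 2 * (n + 1) - 2 - (i : ℕ) = p + 1 by omega, show 2 * n - (i : ℕ) = p + 1 by omega]
  exact reconnect_insertArc_left p (pos_pos D) (pos_ne D (by omega))

lemma partner_ins_left (i : Fin (n + 1 - 1)) : (ins (i + 1) D).partner (topL i) ≠ topR i := by
  have hi := i.isLt
  obtain ⟨p, hp⟩ : ∃ p, p = 2 * n - (i + 1) := ⟨_, rfl⟩
  rw [Ne, partner_topL_iff, pos_ins, ← hp,
    show 2 * (n + 1) - 1 - (i : ℕ) = gap p p by simp [gap]; omega,
    show 2 * (n + 1) - 2 - (i : ℕ) = p + 1 by omega, insertArc_gap]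
  exact (gap_ne _ _).2

lemma stack_ins_right (i : Fin (n + 1 - 1)) {j : ℕ} (hj : (i : ℕ) = j + 1) :
    stack i (ins j D) = ins i D := by
  have hi := i.isLt
  apply pos_inj
  obtain ⟨p, hp⟩ : ∃ p, p = 2 * n - i := ⟨_, rfl⟩
  rw [pos_stack, pos_ins, pos_ins, ← hp, show 2 * (n + 1) - 1 - (i : ℕ) = p + 1 by omega,
    show 2 * (n + 1) - 2 - (i : ℕ) = p by omega, show 2 * n - j = p + 1 by omega]
  exact reconnect_insertArc_right p (pos_pos D) (pos_ne D (by omega))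

lemma partner_ins_right (i : Fin (n + 1 - 1)) {j : ℕ} (hj : (i : ℕ) = j + 1) :
    (ins j D).partner (topL i) ≠ topR i := by
  have hi := i.isLt
  rw [Ne, partner_topL_iff, pos_ins, show 2 * (n + 1) - 1 - (i : ℕ) = 2 * n - j by omega,
    insertArc_self]
  omega

/-- The generator `e_i` placed on top of an inserted arc that it does not touch acts as the
generator `e_{i'}` on the diagram before the insertion. -/
lemma stack_ins_of_ne (i : Fin (n + 1 - 1)) (i' : Fin (n - 1)) {j : ℕ} (hjn : j ≤ n)
    (h : ((i : ℕ) + 1 < j ∧ (i : ℕ) = i') ∨ (j + 1 < i ∧ (i : ℕ) = i' + 2)) :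
    stack i (ins j D) = ins j (stack i' D) ∧
      ((ins j D).partner (topL i) = topR i ↔ D.partner (topL i') = topR i') := by
  have hi := i.isLt
  have hi' := i'.isLt
  have e1 : 2 * (n + 1) - 1 - (i : ℕ) = gap (2 * n - j) (2 * n - 1 - i') := by
    simp only [gap]; split_ifs <;> omega
  have e2 : 2 * (n + 1) - 2 - (i : ℕ) = gap (2 * n - j) (2 * n - 2 - i') := by
    simp only [gap]; split_ifs <;> omega
  constructor
  · apply pos_inj
    rw [pos_stack, pos_ins, pos_ins, pos_stack, e1, e2, reconnect_insertArc_of_ne]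
  · rw [partner_topL_iff, partner_topL_iff, pos_ins, e1, e2, insertArc_gap,
      (gap_injective _).eq_iff]

end stack_ins

/-- The linear extension of the insertion of an arc. -/
def insLin {n : ℕ} (j : ℕ) : (TLDiagram n →₀ K) →ₗ[K] (TLDiagram (n + 1) →₀ K) :=
  Finsupp.lmapDomain K K (ins j)

lemma insLin_single {n : ℕ} (j : ℕ) (D : TLDiagram n) (c : K) :
    insLin j (Finsupp.single D c) = Finsupp.single (ins j D) c := by
  simp [insLin]

section stackLin_insLin

variable {n : ℕ} (z : TLDiagram n →₀ K)

lemma stackLin_insLin_self (i : Fin (n + 1 - 1)) :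
    stackLin i (insLin i z) = -(qInt 2) • insLin i z := by
  induction z using Finsupp.induction_linear with
  | zero => simp
  | add a b ha hb => rw [map_add, map_add, ha, hb, smul_add]
  | single D c =>
    rw [insLin_single, stackLin_single, if_pos (partner_ins_self D i),
      stack_of_loop _ _ (partner_ins_self D i), Finsupp.smul_single, smul_eq_mul, mul_comm]

lemma stackLin_insLin_left (i : Fin (n + 1 - 1)) :
    stackLin i (insLin (i + 1) z) = insLin i z := by
  induction z using Finsupp.induction_linear with
  | zero => simp
  | add a b ha hb => rw [map_add, map_add, ha, hb, map_add]
  | single D c =>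
    rw [insLin_single, stackLin_single, if_neg (partner_ins_left D i), stack_ins_left, mul_one,
      insLin_single]

lemma stackLin_insLin_right (i : Fin (n + 1 - 1)) {j : ℕ} (hj : (i : ℕ) = j + 1) :
    stackLin i (insLin j z) = insLin i z := by
  induction z using Finsupp.induction_linear with
  | zero => simp
  | add a b ha hb => rw [map_add, map_add, ha, hb, map_add]
  | single D c =>
    rw [insLin_single, stackLin_single, if_neg (partner_ins_right D i hj), stack_ins_right D i hj,
      mul_one, insLin_single]

lemma stackLin_insLin_of_ne (i : Fin (n + 1 - 1)) (i' : Fin (n - 1)) {j : ℕ} (hjn : j ≤ n)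
    (h : ((i : ℕ) + 1 < j ∧ (i : ℕ) = i') ∨ (j + 1 < i ∧ (i : ℕ) = i' + 2)) :
    stackLin i (insLin j z) = insLin j (stackLin i' z) := by
  induction z using Finsupp.induction_linear with
  | zero => simp
  | add a b ha hb => rw [map_add, map_add, ha, hb, map_add, map_add]
  | single D c =>
    obtain ⟨h1, h2⟩ := stack_ins_of_ne D i i' hjn h
    rw [insLin_single, stackLin_single, stackLin_single, h1, insLin_single]
    simp only [h2]

end stackLin_insLin

/-! ### The recursive solution of the annihilation equations -/

/-- The expansion of the Jones--Wenzl projection in diagrams, by recursion on the number of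
strands: the small arcs which can be removed from a diagram are weighted by quantum integers. -/
def zeta : (n : ℕ) → TLDiagram n →₀ K
  | 0 => Finsupp.single (idDiagram 0) 1
  | n + 1 => ∑ j ∈ Finset.range (n + 1),
      (qInt ((j + 1 : ℕ) : ℤ) / qInt ((n + 1 : ℕ) : ℤ)) • insLin j (zeta n)

lemma stackLin_zeta {n : ℕ} (i : Fin (n - 1)) : stackLin i (zeta n) = 0 := by
  induction n with
  | zero => exact absurd i.isLt (by omega)
  | succ n ih =>
    have hi := i.isLt
    set w : ℕ → K := fun j => qInt ((j + 1 : ℕ) : ℤ) / qInt ((n + 1 : ℕ) : ℤ) with hw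
    have key : ∀ j ∈ Finset.range (n + 1), stackLin i (w j • insLin j (zeta n)) =
        ((if j = i then -(qInt 2) * w j else 0) + (if j = i + 1 then w j else 0) +
          (if (i : ℕ) = j + 1 then w j else 0)) • insLin i (zeta n) := by
      intro j hj
      rw [Finset.mem_range] at hj
      rw [map_smul]
      rcases lt_trichotomy j i with h | h | h
      · rw [if_neg h.ne, if_neg (by omega)]
        by_cases h1 : (i : ℕ) = j + 1
        · rw [if_pos h1, stackLin_insLin_right _ i h1, zero_add, zero_add]
        · rw [if_neg h1, stackLin_insLin_of_ne _ i ⟨i - 2, by omega⟩ (by omega)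
            (Or.inr ⟨by omega, by simp only; omega⟩), ih]
          simp
      · rw [if_pos h, if_neg (by omega), if_neg (by omega), h, stackLin_insLin_self, smul_smul,
          mul_comm, add_zero, add_zero]
      · rw [if_neg h.ne', if_neg (show ¬ (i : ℕ) = j + 1 by omega)]
        by_cases h1 : j = i + 1
        · rw [if_pos h1, h1, stackLin_insLin_left, zero_add, add_zero]
        · rw [if_neg h1, stackLin_insLin_of_ne _ i ⟨i, by omega⟩ (by omega)
            (Or.inl ⟨by omega, rfl⟩), ih]
          simp
    have h3 : ∑ j ∈ Finset.range (n + 1), (if (i : ℕ) = j + 1 then w j else 0) =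
        qInt ((i : ℕ) : ℤ) / qInt ((n + 1 : ℕ) : ℤ) := by
      rcases hi0 : (i : ℕ) with _ | m
      · simp
      · simp only [Nat.add_right_cancel_iff]
        rw [Finset.sum_ite_eq, if_pos (Finset.mem_range.mpr (by omega))]
    rw [zeta, map_sum, Finset.sum_congr rfl key, ← Finset.sum_smul, Finset.sum_add_distrib,
      Finset.sum_add_distrib, h3, Finset.sum_ite_eq', Finset.sum_ite_eq',
      if_pos (Finset.mem_range.mpr (by omega)), if_pos (Finset.mem_range.mpr (by omega))]
    have h5 := qInt_two_mul (((i : ℕ) + 1 : ℕ) : ℤ)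
    rw [show (((i : ℕ) + 1 : ℕ) : ℤ) - 1 = ((i : ℕ) : ℤ) by push_cast; ring,
      show (((i : ℕ) + 1 : ℕ) : ℤ) + 1 = (((i : ℕ) + 1 + 1 : ℕ) : ℤ) by push_cast; ring] at h5
    have h6 : -(qInt 2) * w i + w (i + 1) + qInt ((i : ℕ) : ℤ) / qInt ((n + 1 : ℕ) : ℤ) = 0 := by
      simp only [hw]
      rw [neg_mul, ← mul_div_assoc, h5]
      ring
    rw [h6, zero_smul]

/-! ### Removal of a small arc -/

/-- In a non-crossing matching, the left end of an arc followed by the right end of an arc belong to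
the same arc. -/
lemma pos_eq_succ_of_lt {n : ℕ} (D : TLDiagram n) {k : ℕ} (h1 : k < pos D k)
    (h2 : pos D (k + 1) < k + 1) : pos D k = k + 1 := by
  by_contra h
  have h3 := pos_pos D (k + 1)
  have h4 : pos D (k + 1) ≠ k := fun h' => h (by rw [← h', h3, h'])
  have := pos_noncrossing D (pos D (k + 1)) k
  omega

/-- The inverse of `gap p` away from the positions `p` and `p + 1`. -/
def ungap (p k : ℕ) : ℕ := if k < p then k else k - 2

lemma gap_ungap {p k : ℕ} (h1 : k ≠ p) (h2 : k ≠ p + 1) : gap p (ungap p k) = k := by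
  simp only [gap, ungap]
  split_ifs <;> omega

/-- The inverse of the insertion: an arc joining two neighbouring positions can be removed. -/
lemma exists_ins_eq {n : ℕ} (D : TLDiagram (n + 1)) {j : ℕ} (hj : j ≤ 2 * n)
    (h : pos D (2 * n - j) = 2 * n - j + 1) : ∃ D' : TLDiagram n, ins j D' = D := by
  obtain ⟨p, hp⟩ : ∃ p, p = 2 * n - j := ⟨_, rfl⟩
  rw [← hp] at h
  have h' : pos D (p + 1) = p := by rw [← h, pos_pos]
  have key : ∀ k, gap p (ungap p (pos D (gap p k))) = pos D (gap p k) := fun k =>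
    gap_ungap (fun e => (gap_ne p k).2 (pos_injective D (by rw [e, h'])))
      (fun e => (gap_ne p k).1 (pos_injective D (by rw [e, h])))
  have hgap : ∀ k, gap p k < 2 * (n + 1) ↔ k < 2 * n := by
    intro k
    simp only [gap]
    split_ifs <;> omega
  refine ⟨ofPos (fun k => ungap p (pos D (gap p k))) (fun k hk => ?_) (fun k => ?_)
    (fun k hk e => ?_) (fun a b => ?_), ?_⟩
  · rw [← hgap, key]
    exact pos_lt D ((hgap k).mpr hk)
  · apply gap_injective p
    rw [key, key, pos_pos]
  · have := congrArg (gap p) e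
    rw [key] at this
    exact pos_ne D ((hgap k).mpr hk) this
  · have := pos_noncrossing D (gap p a) (gap p b)
    rwa [← key a, ← key b, gap_lt_gap, gap_lt_gap, gap_lt_gap] at this
  · apply pos_inj
    funext k
    rw [pos_ins, ← hp]
    by_cases k1 : k = p
    · rw [k1, insertArc_self, h]
    by_cases k2 : k = p + 1
    · rw [k2, insertArc_succ, h']
    obtain ⟨i, rfl⟩ := exists_gap_eq k1 k2
    rw [insertArc_gap]
    by_cases hi : i < 2 * n
    · rw [pos_ofPos _ _ _ _ hi, key]
    · rw [pos_of_le _ (not_lt.mp hi), pos_of_le]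
      exact not_lt.mp fun h => hi ((hgap i).mp h)

/-- Some small arc can be removed: otherwise all of the last `n + 2` positions would be right ends
of arcs, whose left ends would be among the first `n` positions. -/
lemma exists_pos_eq_succ {n : ℕ} (D : TLDiagram (n + 1)) :
    ∃ j ≤ n, pos D (2 * n - j) = 2 * n - j + 1 := by
  by_contra! hno
  have hdown : ∀ m ≤ n + 1, pos D (2 * n + 1 - m) < 2 * n + 1 - m := by
    intro m
    induction m with
    | zero =>
      intro _
      have h1 := pos_lt D (show 2 * n + 1 < 2 * (n + 1) by omega)
      have h2 := pos_ne D (show 2 * n + 1 < 2 * (n + 1) by omega)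
      simp only [Nat.sub_zero]
      omega
    | succ m ih =>
      intro hm
      have h1 := ih (by omega)
      have h2 := hno m (by omega)
      have h3 := pos_ne D (show 2 * n - m < 2 * (n + 1) by omega)
      rw [show 2 * n + 1 - m = 2 * n - m + 1 by omega] at h1
      rw [show 2 * n + 1 - (m + 1) = 2 * n - m by omega]
      by_contra h4
      exact h2 (pos_eq_succ_of_lt D (by omega) h1)
  have hlt : ∀ k, n ≤ k → k < 2 * n + 2 → pos D k < k := by
    intro k h1 h2
    have := hdown (2 * n + 1 - k) (by omega)
    rwa [show 2 * n + 1 - (2 * n + 1 - k) = k by omega] at this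
  have hcard := Finset.card_le_card_of_injOn (s := Finset.Ico n (2 * n + 2)) (t := Finset.range n)
    (pos D) (fun k hk => by
      simp only [Finset.coe_Ico, Set.mem_Ico, Finset.coe_range, Set.mem_Iio] at hk ⊢
      by_contra h
      have h1 := hlt k hk.1 hk.2
      have h2 := hlt (pos D k) (by omega) (by omega)
      rw [pos_pos] at h2
      omega) ((pos_injective D).injOn)
  rw [Nat.card_Ico, Finset.card_range] at hcard
  omega

lemma TLDiagram.eq_of_zero (D E : TLDiagram 0) : D = E := by
  ext1
  funext x
  rcases x with x | x <;> exact x.elim0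

lemma ins_idDiagram (n : ℕ) : ins n (idDiagram n) = idDiagram (n + 1) := by
  apply pos_inj
  funext k
  by_cases hk : k < 2 * (n + 1)
  · rw [pos_idDiagram hk, pos_ins]
    have h1 : k < 2 * n → pos (idDiagram n) k = 2 * n - 1 - k := pos_idDiagram
    have h2 : k - 2 < 2 * n → pos (idDiagram n) (k - 2) = 2 * n - 1 - (k - 2) := pos_idDiagram
    simp only [insertArc, gap]
    split_ifs <;> omega
  · rw [pos_of_le _ (not_lt.mp hk), pos_of_le _ (not_lt.mp hk)]

lemma partner_idDiagram_topL {n : ℕ} (i : Fin (n - 1)) :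
    (idDiagram n).partner (topL i) ≠ topR i := by
  simp [idDiagram, topL, topR]

/-- Every diagram but the identity joins two neighbouring top points. -/
lemma exists_partner_topL {n : ℕ} (D : TLDiagram n) (hD : D ≠ idDiagram n) :
    ∃ i : Fin (n - 1), D.partner (topL i) = topR i := by
  induction n with
  | zero => exact absurd (D.eq_of_zero _) hD
  | succ n ih =>
    obtain ⟨j, hj, hp⟩ := exists_pos_eq_succ D
    obtain ⟨D', rfl⟩ := exists_ins_eq D (by omega) hp
    rcases hj.lt_or_eq with hj | rfl
    · exact ⟨⟨j, by omega⟩, partner_ins_self D' ⟨j, by omega⟩⟩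
    · obtain ⟨i, hi⟩ := ih D' (fun h => hD (by rw [h, ins_idDiagram]))
      have := i.isLt
      refine ⟨⟨i, by omega⟩, ?_⟩
      exact (stack_ins_of_ne D' ⟨i, by omega⟩ i le_rfl (Or.inl ⟨by simp only; omega, rfl⟩)).2.mpr hi

lemma zeta_succ_apply {n : ℕ} (D : TLDiagram (n + 1)) :
    zeta (n + 1) D = ∑ j ∈ Finset.range (n + 1),
      (qInt ((j + 1 : ℕ) : ℤ) / qInt ((n + 1 : ℕ) : ℤ)) * insLin j (zeta n) D := by
  simp [zeta, Finsupp.finsetSum_apply]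

lemma insLin_apply {n : ℕ} (j : ℕ) (z : TLDiagram n →₀ K) (D : TLDiagram n) :
    insLin j z (ins j D) = z D :=
  Finsupp.mapDomain_apply (ins_injective j) z D

lemma insLin_apply_of_notMem {n : ℕ} (j : ℕ) (z : TLDiagram n →₀ K) (D : TLDiagram (n + 1))
    (h : ∀ D', ins j D' ≠ D) : insLin j z D = 0 :=
  Finsupp.mapDomain_of_notMem_range z D fun ⟨D', h'⟩ => h D' h'

lemma zeta_idDiagram (n : ℕ) : zeta n (idDiagram n) = 1 := by
  induction n with
  | zero => simp [zeta]
  | succ n ih =>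
    rw [zeta_succ_apply, Finset.sum_eq_single n]
    · rw [← ins_idDiagram, insLin_apply, ih, mul_one]
      exact div_self (qInt_natCast_ne_zero (by omega))
    · intro j hj hjn
      have hj' := Finset.mem_range.mp hj
      rw [insLin_apply_of_notMem, mul_zero]
      intro D' h
      have h1 := partner_ins_self D' ⟨j, by omega⟩
      simp only [h] at h1
      exact partner_idDiagram_topL _ h1
    · intro h
      exact absurd (Finset.mem_range.mpr (by omega)) h

/-- The projection kills all diagrams but the identity: such a diagram `D` satisfies
`e_i D = -[2] D` for some `i`, while `P e_i = 0`. -/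
lemma IsJonesWenzl.diagramRep_apply {n : ℕ} {P : TLAlgebra n} (hP : IsJonesWenzl P)
    (z : TLDiagram n →₀ K) : diagramRep n P z = z (idDiagram n) • toDiagrams P := by
  induction z using Finsupp.induction_linear with
  | zero => simp
  | add a b ha hb => rw [map_add, ha, hb, Finsupp.add_apply, add_smul]
  | single D c =>
    by_cases hD : D = idDiagram n
    · subst hD
      rw [Finsupp.single_eq_same, toDiagrams, ← map_smul, Finsupp.smul_single, smul_eq_mul, mul_one]
    · rw [Finsupp.single_eq_of_ne' hD, zero_smul]
      obtain ⟨i, hi⟩ := exists_partner_topL D hD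
      have h1 : diagramRep n (P * e i) (Finsupp.single D c) = 0 := by
        rw [(hP.2.2 i).2, map_zero, LinearMap.zero_apply]
      rw [map_mul, Module.End.mul_apply, diagramRep_e, stackLin_single, stack_of_loop _ _ hi,
        if_pos hi, mul_comm, ← smul_eq_mul, ← Finsupp.smul_single, map_smul] at h1
      exact (smul_eq_zero.mp h1).resolve_left (neg_ne_zero.mpr (qInt_natCast_ne_zero two_ne_zero))

/-- A combination of diagrams that is killed by the generators is determined by its coefficient at
the identity, which identifies the projection with `zeta n`. -/
lemma IsJonesWenzl.toDiagrams_eq {n : ℕ} {P : TLAlgebra n} (hP : IsJonesWenzl P) :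
    toDiagrams P = zeta n := by
  have h := hP.diagramRep_apply (zeta n)
  rw [diagramRep_eq_aug_smul stackLin_zeta, hP.aug_eq_one, one_smul, zeta_idDiagram,
    one_smul] at h
  exact h.symm

/-! ### Heights of lattice paths -/

@[simp] lemma height_zero (w : List DyckStep) : height w 0 = 0 := by simp [height]

lemma height_succ (w : List DyckStep) {k : ℕ} (hk : k < w.length) :
    height w (k + 1) = height w k + if w[k] = DyckStep.U then 1 else -1 := by
  simp only [height, List.take_succ_eq_append_getElem hk, List.count_append, List.count_singleton]
  cases w[k] <;> simp <;> ring

lemma height_succ_or (w : List DyckStep) {k : ℕ} (hk : k < w.length) :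
    height w (k + 1) = height w k + 1 ∨ height w (k + 1) = height w k - 1 := by
  rw [height_succ w hk]
  split_ifs
  · exact Or.inl rfl
  · exact Or.inr rfl

lemma height_of_length_le (μ : DyckWord) {k : ℕ} (hk : 2 * μ.semilength ≤ k) :
    height μ.toList k = 0 := by
  rw [μ.two_mul_semilength_eq_length] at hk
  rw [height, List.take_of_length_le hk, μ.count_U_eq_count_D, sub_self]

lemma height_nonneg (μ : DyckWord) (k : ℕ) : 0 ≤ height μ.toList k := by
  have := μ.count_D_le_count_U k
  rw [height]
  omega

lemma height_le (w : List DyckStep) (k : ℕ) : height w k ≤ k := by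
  have h1 := List.count_le_length (a := DyckStep.U) (l := w.take k)
  have h2 : (w.take k).length ≤ k := List.length_take_le k w
  rw [height]
  omega

lemma height_parity (w : List DyckStep) {k : ℕ} (hk : k ≤ w.length) : Even (height w k + k) := by
  induction k with
  | zero => simp
  | succ k ih =>
    obtain ⟨m, hm⟩ := ih (by omega)
    rcases height_succ_or w (show k < w.length by omega) with h | h
    · exact ⟨m + 1, by rw [h]; push_cast; linarith⟩
    · exact ⟨m, by rw [h]; push_cast; linarith⟩

lemma height_le_sub (μ : DyckWord) {k : ℕ} (hk : k ≤ 2 * μ.semilength) :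
    height μ.toList k ≤ 2 * μ.semilength - k := by
  obtain ⟨m, hm⟩ := Nat.exists_eq_add_of_le hk
  induction m generalizing k with
  | zero => rw [height_of_length_le μ (by omega)]; omega
  | succ m ih =>
    have h1 := ih (k := k + 1) (by omega) (by omega)
    have h2 := height_succ_or μ.toList (k := k) (by
      rw [← μ.two_mul_semilength_eq_length]; omega)
    push_cast at h1
    omega

lemma height_topSteps (n k : ℕ) :
    height (topSteps n) k = (min k n : ℕ) - (min (k - n) n : ℕ) := by
  simp [height, topSteps, List.take_append, List.take_replicate, List.count_replicate]

/-- A box of the region above `μ` lies below the two sides of the triangle `U^n D^n`. -/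
lemma mem_region {μ : DyckWord} {s : Box} : s ∈ region μ ↔ Odd ((s.1 : ℤ) + s.2) ∧
    height μ.toList s.1 < s.2 ∧ s.2 < s.1 ∧ s.1 + s.2 < 2 * μ.semilength := by
  have h0 := height_nonneg μ s.1
  simp only [region, Finset.mem_filter, Finset.mem_product, Finset.mem_range, Finset.mem_Icc,
    height_topSteps]
  constructor
  · rintro ⟨⟨h1, h2, h3⟩, h4, h5, h6⟩
    exact ⟨h4, by omega, by omega, by omega⟩
  · rintro ⟨h4, h5, h6, h7⟩
    exact ⟨⟨by omega, by omega, by omega⟩, h4, by omega, by omega⟩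

/-! ### Dyck tiles as graphs of functions -/

/-- The word of up and down steps of the first `m` increments of `f` after `a`. -/
def stepWord (f : ℕ → ℤ) (a m : ℕ) : List DyckStep :=
  (List.range m).map fun k => if f (a + k) < f (a + k + 1) then DyckStep.U else DyckStep.D

lemma height_stepWord {f : ℕ → ℤ} {a m : ℕ}
    (hf : ∀ x, a ≤ x → x < a + m → f (x + 1) = f x + 1 ∨ f (x + 1) = f x - 1) {k : ℕ}
    (hk : k ≤ m) : height (stepWord f a m) k = f (a + k) - f a := by
  induction k with
  | zero => simp
  | succ k ih =>
    have hlen : k < (stepWord f a m).length := by simp [stepWord]; omega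
    rw [height_succ _ hlen, ih (by omega)]
    have h1 := hf (a + k) (by omega) (by omega)
    have h2 : (stepWord f a m)[k] =
        if f (a + k) < f (a + k + 1) then DyckStep.U else DyckStep.D := by
      simp [stepWord]
    rw [h2, ← add_assoc]
    split_ifs with h3 h4 h4
    · omega
    · simp at h4
    · simp at h4
    · omega

/-- A Dyck tile is the graph of a function on an interval with steps `±1` whose minimum is attained
at both ends. -/
lemma isDyckTile_iff {d : Finset Box} : IsDyckTile d ↔ ∃ (a b : ℕ) (f : ℕ → ℤ), a ≤ b ∧
    (∀ x, a ≤ x → x < b → f (x + 1) = f x + 1 ∨ f (x + 1) = f x - 1) ∧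
    (∀ x, a ≤ x → x ≤ b → f a ≤ f x) ∧ f b = f a ∧
    ∀ s : Box, s ∈ d ↔ a ≤ s.1 ∧ s.1 ≤ b ∧ s.2 = f s.1 := by
  constructor
  · rintro ⟨s, v, rfl⟩
    refine ⟨s.1, s.1 + 2 * v.semilength, fun x => s.2 + height v.toList (x - s.1), by omega,
      fun x h1 h2 => ?_, fun x h1 h2 => ?_, ?_, fun t => ?_⟩
    · have := height_succ_or v.toList (k := x - s.1) (by
        rw [← v.two_mul_semilength_eq_length]; omega)
      simp only
      rw [show x + 1 - s.1 = x - s.1 + 1 by omega]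
      omega
    · have := height_nonneg v (x - s.1)
      simp [this]
    · simp [height_of_length_le]
    · simp only [Finset.mem_image, Finset.mem_range, Prod.ext_iff]
      constructor
      · rintro ⟨k, h1, h2, h3⟩
        refine ⟨by omega, by omega, ?_⟩
        rw [← h3, ← h2, Nat.add_sub_cancel_left]
      · rintro ⟨h1, h2, h3⟩
        exact ⟨t.1 - s.1, by omega, by omega, h3.symm⟩
  · rintro ⟨a, b, f, hab, hstep, hmin, hend, hd⟩
    obtain ⟨m, rfl⟩ := Nat.exists_eq_add_of_le hab
    have hh : ∀ k ≤ m, height (stepWord f a m) k = f (a + k) - f a :=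
      fun k hk => height_stepWord hstep hk
    have hlen : (stepWord f a m).length = m := by simp [stepWord]
    let v : DyckWord := ⟨stepWord f a m, by
        have h1 := hh m le_rfl
        rw [hend, height, List.take_of_length_le hlen.le] at h1
        omega, fun k => by
        rcases le_total k m with hk | hk
        · have h1 := hh k hk
          have h2 := hmin (a + k) (by omega) (by omega)
          rw [height] at h1
          omega
        · have h1 := hh m le_rfl
          rw [hend, height, List.take_of_length_le hlen.le] at h1
          rw [List.take_of_length_le (by omega)]
          omega⟩
    have hv : 2 * v.semilength = m := by rw [v.two_mul_semilength_eq_length]; exact hlen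
    refine ⟨(a, f a), v, ?_⟩
    ext t
    rw [hd, hv]
    simp only [Finset.mem_image, Finset.mem_range, Prod.ext_iff]
    constructor
    · rintro ⟨h1, h2, h3⟩
      refine ⟨t.1 - a, by omega, by omega, ?_⟩
      rw [show v.toList = stepWord f a m from rfl, hh _ (by omega), h3,
        show a + (t.1 - a) = t.1 by omega]
      ring
    · rintro ⟨k, h1, h2, h3⟩
      refine ⟨by omega, by omega, ?_⟩
      rw [← h3, ← h2, show v.toList = stepWord f a m from rfl, hh _ (by omega)]
      ring

lemma IsDyckTile.nonempty {d : Finset Box} (h : IsDyckTile d) : d.Nonempty := by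
  obtain ⟨a, b, f, hab, -, -, -, hd⟩ := isDyckTile_iff.mp h
  exact ⟨(a, f a), (hd _).mpr ⟨le_rfl, hab, rfl⟩⟩

lemma isDyckTile_singleton (s : Box) : IsDyckTile {s} := by
  refine isDyckTile_iff.mpr ⟨s.1, s.1, fun _ => s.2, le_rfl, fun x _ _ => by omega,
    fun x _ _ => le_rfl, rfl, fun t => ?_⟩
  rw [Finset.mem_singleton, Prod.ext_iff]
  simp only
  omega

lemma tileHeight_singleton (s : Box) : tileHeight {s} = s.2 := by simp [tileHeight]

lemma IsDyckTile.exists_isLeast {d : Finset Box} (h : IsDyckTile d) :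
    ∃ m, IsLeast (Prod.snd '' (d : Set Box)) m := by
  obtain ⟨a, b, f, hab, -, hmin, -, hd⟩ := isDyckTile_iff.mp h
  refine ⟨f a, ⟨(a, f a), Finset.mem_coe.mpr ((hd _).mpr ⟨le_rfl, hab, rfl⟩), rfl⟩, ?_⟩
  rintro _ ⟨s, hs, rfl⟩
  obtain ⟨h1, h2, h3⟩ := (hd s).mp (Finset.mem_coe.mp hs)
  rw [h3]
  exact hmin _ h1 h2

lemma mem_shiftDown {d : Finset Box} {s : Box} : s ∈ shiftDown d ↔ (s.1, s.2 + 2) ∈ d := by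
  simp only [shiftDown, Finset.mem_image, Prod.ext_iff]
  constructor
  · rintro ⟨t, ht, h1, h2⟩
    convert ht using 2
    · exact h1.symm
    · omega
  · intro h
    exact ⟨_, h, rfl, by simp⟩

lemma IsDyckTile.not_shiftDown_subset {d : Finset Box} (h : IsDyckTile d) : ¬ shiftDown d ⊆ d := by
  intro hsub
  obtain ⟨a, b, f, hab, -, -, -, hd⟩ := isDyckTile_iff.mp h
  have h1 : ((a, f a - 2) : Box) ∈ d := hsub (mem_shiftDown.mpr ((hd _).mpr
    ⟨le_rfl, hab, by simp⟩))
  have h2 := ((hd _).mp h1).2.2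
  simp only at h2
  omega

/-! ### Widening of tiles -/

/-- The map of boxes that contracts the three columns `p`, `p + 1`, `p + 2` to the column `p`, so
that the boxes of a peak with its apex in the column `p + 1` are identified. -/
def collapse (p : ℕ) (s : Box) : Box :=
  if s.1 ≤ p then s else if s.1 = p + 1 then (p, s.2 - 1) else (s.1 - 2, s.2)

lemma collapse_of_le {p x : ℕ} (h : x ≤ p) (y : ℤ) : collapse p (x, y) = (x, y) := if_pos h

lemma collapse_apex (p : ℕ) (y : ℤ) : collapse p (p + 1, y) = (p, y - 1) := by simp [collapse]

lemma collapse_add_two {p x : ℕ} (h : p ≤ x) (y : ℤ) : collapse p (x + 2, y) = (x, y) := by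
  simp only [collapse]
  rw [if_neg (by omega), if_neg (by omega), Nat.add_sub_cancel]

lemma collapse_surjective (p : ℕ) (s : Box) : ∃ t, collapse p t = s ∧ t.2 = s.2 := by
  rcases le_total s.1 p with h | h
  · exact ⟨s, collapse_of_le h _, rfl⟩
  · exact ⟨(s.1 + 2, s.2), collapse_add_two h _, rfl⟩

lemma collapse_snd_le (p : ℕ) (s : Box) : (collapse p s).2 ≤ s.2 := by
  unfold collapse
  split_ifs <;> simp

lemma collapse_add (p x : ℕ) (y z : ℤ) :
    collapse p (x, y + z) = ((collapse p (x, y)).1, (collapse p (x, y)).2 + z) := by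
  simp only [collapse]
  split_ifs
  · rfl
  · simp only [Prod.mk.injEq, true_and]; ring
  · rfl

open Classical in
/-- The widening of a set of boxes at the column `p`: its preimage under `collapse p`. It inserts a
peak into every tile that meets the column `p` and shifts the boxes on the right of this column. -/
def widen (p : ℕ) (d : Finset Box) : Finset Box :=
  (d ∪ d.image (fun s => (s.1 + 1, s.2 + 1)) ∪ d.image fun s => (s.1 + 2, s.2)).filter
    fun s => collapse p s ∈ d

lemma mem_widen {p : ℕ} {d : Finset Box} {s : Box} : s ∈ widen p d ↔ collapse p s ∈ d := by
  simp only [widen, Finset.mem_filter, Finset.mem_union, Finset.mem_image, and_iff_right_iff_imp]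
  intro h
  unfold collapse at h
  split_ifs at h with h1 h2
  · exact Or.inl (Or.inl h)
  · exact Or.inl (Or.inr ⟨_, h, by ext <;> simp [h2]⟩)
  · exact Or.inr ⟨_, h, by ext <;> simp; omega⟩

lemma widen_subset_widen {p : ℕ} {d t : Finset Box} : widen p d ⊆ widen p t ↔ d ⊆ t := by
  constructor
  · intro h s hs
    obtain ⟨r, rfl, -⟩ := collapse_surjective p s
    exact mem_widen.mp (h (mem_widen.mpr hs))
  · intro h s hs
    exact mem_widen.mpr (h (mem_widen.mp hs))

lemma widen_injective (p : ℕ) : Function.Injective (widen p) := fun _ _ h =>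
  Finset.Subset.antisymm (widen_subset_widen.mp h.le) (widen_subset_widen.mp h.ge)

lemma shiftDown_widen (p : ℕ) (d : Finset Box) :
    shiftDown (widen p d) = widen p (shiftDown d) := by
  ext ⟨x, y⟩
  rw [mem_shiftDown, mem_widen, mem_widen, mem_shiftDown, collapse_add]

lemma tileHeight_widen (p : ℕ) {d : Finset Box} (hd : IsDyckTile d) :
    tileHeight (widen p d) = tileHeight d := by
  obtain ⟨m, hm⟩ := hd.exists_isLeast
  have h : IsLeast (Prod.snd '' (widen p d : Set Box)) m := by
    obtain ⟨⟨s, hs, rfl⟩, h2⟩ := hm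
    obtain ⟨t, rfl, ht⟩ := collapse_surjective p s
    refine ⟨⟨t, Finset.mem_coe.mpr (mem_widen.mpr (Finset.mem_coe.mp hs)), ht⟩, ?_⟩
    rintro _ ⟨r, hr, rfl⟩
    exact (h2 ⟨_, Finset.mem_coe.mpr (mem_widen.mp (Finset.mem_coe.mp hr)), rfl⟩).trans
      (collapse_snd_le p r)
  rw [tileHeight, tileHeight, h.csInf_eq, hm.csInf_eq]

lemma IsDyckTile.widen {d : Finset Box} (h : IsDyckTile d) (p : ℕ) :
    IsDyckTile (widen p d) := by
  obtain ⟨a, b, f, hab, hstep, hmin, hend, hd⟩ := isDyckTile_iff.mp h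
  refine isDyckTile_iff.mpr ⟨if p < a then a + 2 else a, if p ≤ b then b + 2 else b,
    fun x => if x ≤ p then f x else if x = p + 1 then f p + 1 else f (x - 2), ?_, ?_, ?_, ?_, ?_⟩
  · split_ifs <;> omega
  · intro x h1 h2
    have e1 := hstep x
    have e2 := hstep (x - 2)
    grind
  · intro x h1 h2
    have e1 := hmin x
    have e2 := hmin (x - 2)
    have e3 := hmin p
    grind
  · grind
  · rintro ⟨x, y⟩
    rw [mem_widen, hd]
    simp only [collapse]
    grind

lemma isDyckTile_of_widen {d : Finset Box} {p : ℕ} (h : IsDyckTile (widen p d)) :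
    IsDyckTile d := by
  obtain ⟨a, b, f, hab, hstep, hmin, hend, hd⟩ := isDyckTile_iff.mp h
  simp only [mem_widen] at hd
  have hle : ∀ x ≤ p, ∀ y : ℤ, (x, y) ∈ d ↔ a ≤ x ∧ x ≤ b ∧ y = f x := fun x hx y => by
    rw [← hd (x, y), collapse_of_le hx]
  have hge : ∀ x, p ≤ x → ∀ y : ℤ, (x, y) ∈ d ↔ a ≤ x + 2 ∧ x + 2 ≤ b ∧ y = f (x + 2) :=
    fun x hx y => by rw [← hd (x + 2, y), collapse_add_two hx]
  have hap : ∀ y : ℤ, (p, y) ∈ d ↔ a ≤ p + 1 ∧ p + 1 ≤ b ∧ y + 1 = f (p + 1) := fun y => by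
    rw [← hd (p + 1, y + 1), collapse_apex, add_sub_cancel_right]
  have c1 := hle p le_rfl
  have c2 := hge p le_rfl
  -- the three columns `p`, `p + 1` and `p + 2` are met simultaneously
  have k1 : (a ≤ p ∧ p ≤ b) ↔ (a ≤ p + 1 ∧ p + 1 ≤ b) := by
    constructor
    · rintro ⟨h1, h2⟩
      have := (hap (f p)).mp ((c1 _).mpr ⟨h1, h2, rfl⟩)
      exact ⟨this.1, this.2.1⟩
    · rintro ⟨h1, h2⟩
      have := (c1 _).mp ((hap (f (p + 1) - 1)).mpr ⟨h1, h2, by ring⟩)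
      exact ⟨this.1, this.2.1⟩
  have k2 : (a ≤ p ∧ p ≤ b) ↔ (a ≤ p + 2 ∧ p + 2 ≤ b) := by
    constructor
    · rintro ⟨h1, h2⟩
      have := (c2 (f p)).mp ((c1 _).mpr ⟨h1, h2, rfl⟩)
      exact ⟨this.1, this.2.1⟩
    · rintro ⟨h1, h2⟩
      have := (c1 _).mp ((c2 (f (p + 2))).mpr ⟨h1, h2, rfl⟩)
      exact ⟨this.1, this.2.1⟩
  by_cases hp : a ≤ p ∧ p ≤ b
  · have e1 : f p = f (p + 2) :=
      ((c2 (f p)).mp ((c1 _).mpr ⟨hp.1, hp.2, rfl⟩)).2.2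
    have hp2 := k2.mp hp
    refine isDyckTile_iff.mpr ⟨a, b - 2, fun x => if x ≤ p then f x else f (x + 2), by omega,
      ?_, ?_, ?_, ?_⟩
    · intro x h1 h2
      have e2 := hstep x
      have e3 := hstep (x + 2)
      grind
    · intro x h1 h2
      have e2 := hmin x
      have e3 := hmin (x + 2)
      grind
    · grind
    · rintro ⟨x, y⟩
      simp only
      rcases le_total x p with hx | hx
      · rw [hle x hx, if_pos hx]
        omega
      · rw [hge x hx]
        split_ifs with h1
        · rw [show x = p by omega, e1]; omega
        · omega
  · rcases Nat.lt_or_ge b (p + 1) with hb | hb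
    · refine isDyckTile_iff.mpr ⟨a, b, f, hab, hstep, hmin, hend, ?_⟩
      rintro ⟨x, y⟩
      simp only
      rcases le_total x p with hx | hx
      · rw [hle x hx]
      · rw [hge x hx]
        omega
    · refine isDyckTile_iff.mpr ⟨a - 2, b - 2, fun x => f (x + 2), by omega, ?_, ?_, ?_, ?_⟩
      · intro x h1 h2
        exact hstep (x + 2) (by omega) (by omega)
      · intro x h1 h2
        simp only
        rw [show a - 2 + 2 = a by omega]
        exact hmin (x + 2) (by omega) (by omega)
      · simp only
        rw [show a - 2 + 2 = a by omega, show b - 2 + 2 = b by omega, hend]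
      · rintro ⟨x, y⟩
        simp only
        rcases le_total x p with hx | hx
        · rw [hle x hx]
          omega
        · rw [hge x hx]
          omega

/-! ### Tilings as sets of tiles -/

/-- The set `P` of tiles is a cover-inclusive Dyck tiling of the region above `μ`. In `inclusive`
the tile `t` is automatically different from `d`, since a tile does not contain its own
translate. -/
structure IsTilingSet (μ : DyckWord) (P : Finset (Finset Box)) : Prop where
  tile : ∀ d ∈ P, IsDyckTile d
  subset : ∀ d ∈ P, d ⊆ region μ
  cover : ∀ s ∈ region μ, ∃ d ∈ P, s ∈ d
  eq_of_mem : ∀ d ∈ P, ∀ t ∈ P, ∀ s ∈ d, s ∈ t → d = t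
  inclusive : ∀ d ∈ P, (∀ s ∈ shiftDown d, s.2 < height μ.toList s.1) ∨
    ∃ t ∈ P, shiftDown d ⊆ t

/-- The cover-inclusive Dyck tilings above `μ`, each given by its set of tiles. -/
def tilingSets (μ : DyckWord) : Finset (Finset (Finset Box)) :=
  (coverInclusiveDyckTilings μ).image fun T => T.parts

lemma mem_tilingSets {μ : DyckWord} {P : Finset (Finset Box)} :
    P ∈ tilingSets μ ↔ IsTilingSet μ P := by
  simp only [tilingSets, coverInclusiveDyckTilings, Finset.mem_image, Finset.mem_filter,
    Finset.mem_univ, true_and]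
  constructor
  · rintro ⟨T, ⟨h1, h2⟩, rfl⟩
    refine ⟨h1, fun d hd => T.le hd, fun s hs => T.exists_mem hs,
      fun d hd t ht s hs hs' => T.eq_of_mem_parts hd ht hs hs', fun d hd => ?_⟩
    rcases h2 d hd with h | ⟨t, ht, -, h⟩
    · exact Or.inl h
    · exact Or.inr ⟨t, ht, h⟩
  · intro h
    refine ⟨⟨P, ?_, ?_, ?_⟩, ⟨h.tile, fun d hd => ?_⟩, rfl⟩
    · rw [Finset.supIndep_iff_pairwiseDisjoint]
      intro d hd t ht hne
      refine Finset.disjoint_left.mpr fun s hs hs' => hne ?_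
      exact h.eq_of_mem d hd t ht s hs hs'
    · ext s
      simp only [Finset.mem_sup, id]
      exact ⟨fun ⟨d, hd, hs⟩ => h.subset d hd hs, h.cover s⟩
    · intro h0
      exact (h.tile _ h0).nonempty.ne_empty rfl
    · rcases h.inclusive d hd with h' | ⟨t, ht, h'⟩
      · exact Or.inl h'
      · refine Or.inr ⟨t, ht, ?_, h'⟩
        rintro rfl
        exact (h.tile _ hd).not_shiftDown_subset h'

/-- The weight of a tile. -/
def tileWeight (d : Finset Box) : K := qInt (tileHeight d) / qInt (tileHeight d + 1)

lemma Z_eq_sum (μ : DyckWord) : Z μ = ∑ P ∈ tilingSets μ, ∏ d ∈ P, tileWeight d := by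
  rw [tilingSets, Finset.sum_image]
  · rfl
  · intro T _ T' _ h
    exact Finpartition.ext h

/-! ### Insertion of a peak and of a strip of single boxes -/

/-- The path `μ`, of semilength `n + 1`, arises from `μ'`, of semilength `n`, by the insertion of a
peak after `p` steps, at or to the right of the middle of `μ'`. -/
structure IsPeakInsertion (n p : ℕ) (μ' μ : DyckWord) : Prop where
  semilength_left : μ'.semilength = n
  semilength_right : μ.semilength = n + 1
  le : n ≤ p
  le_two_mul : p ≤ 2 * n
  height : ∀ x, height μ.toList x = if x ≤ p then height μ'.toList x
    else if x = p + 1 then height μ'.toList p + 1 else height μ'.toList (x - 2)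

/-- The single box in the column `x` below the right side of the triangle `U^(n+1) D^(n+1)`. -/
def sideTile (n x : ℕ) : Finset Box := {((x, 2 * n + 1 - x) : Box)}

lemma mem_sideTile {n x : ℕ} {s : Box} :
    s ∈ sideTile n x ↔ s.1 = x ∧ s.2 = 2 * n + 1 - x := by
  rw [sideTile, Finset.mem_singleton, Prod.ext_iff]

lemma sideTile_injective (n : ℕ) : Function.Injective (sideTile n) := by
  intro x y h
  simp only [sideTile, Finset.singleton_inj, Prod.mk.injEq] at h
  exact h.1

/-- The strip of single boxes that fills the triangle again after the insertion of a peak. -/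
def strip (n p : ℕ) : Finset (Finset Box) := (Finset.Ioc n p).image (sideTile n)

lemma mem_strip {n p : ℕ} {d : Finset Box} :
    d ∈ strip n p ↔ ∃ x, (n < x ∧ x ≤ p) ∧ sideTile n x = d := by
  simp [strip]

/-- The tiling obtained by the insertion of a peak and of a strip. -/
def growTiling (n p : ℕ) (P : Finset (Finset Box)) : Finset (Finset Box) :=
  P.image (widen p) ∪ strip n p

lemma mem_growTiling {n p : ℕ} {P : Finset (Finset Box)} {d : Finset Box} :
    d ∈ growTiling n p P ↔ (∃ t ∈ P, widen p t = d) ∨ ∃ x, (n < x ∧ x ≤ p) ∧ sideTile n x = d := by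
  rw [growTiling, Finset.mem_union, mem_strip, Finset.mem_image]

/-- The run of single boxes below the right side of the triangle, starting in the middle, ends
exactly at the column `p`. -/
def HasRun (n p : ℕ) (P : Finset (Finset Box)) : Prop :=
  (∀ x, n < x → x ≤ p → sideTile n x ∈ P) ∧ sideTile n (p + 1) ∉ P

lemma hasRun_growTiling (n p : ℕ) (P : Finset (Finset Box)) : HasRun n p (growTiling n p P) := by
  refine ⟨fun x h1 h2 => mem_growTiling.mpr (Or.inr ⟨x, ⟨h1, h2⟩, rfl⟩), fun h => ?_⟩
  rcases mem_growTiling.mp h with ⟨d, -, h1⟩ | ⟨x, hx, h1⟩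
  · have h2 : ((p + 1, 2 * n + 1 - (p + 1 : ℕ)) : Box) ∈ widen p d := by
      rw [h1, mem_sideTile]; exact ⟨rfl, rfl⟩
    rw [mem_widen, collapse_apex, ← collapse_of_le le_rfl, ← mem_widen, h1, mem_sideTile] at h2
    simp at h2
  · have := sideTile_injective n h1
    omega

namespace IsPeakInsertion

variable {n p : ℕ} {μ' μ : DyckWord}

/-- The map `collapse p` preserves the vertical position of a box relative to the path. -/
lemma height_sub (H : IsPeakInsertion n p μ' μ) (s : Box) :
    JonesWenzl.height μ.toList s.1 - s.2 =
    JonesWenzl.height μ'.toList (collapse p s).1 - (collapse p s).2 := by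
  rw [H.height]
  simp only [collapse]
  split_ifs
  · rfl
  · simp only; ring
  · rfl

/-- The region above the large path is the preimage of the region above the small path together
with the strip. -/
lemma mem_region_iff (H : IsPeakInsertion n p μ' μ) (s : Box) : s ∈ region μ ↔
    collapse p s ∈ region μ' ∨ (n < s.1 ∧ s.1 ≤ p) ∧ s.2 = 2 * n + 1 - s.1 := by
  have h := H.height_sub s
  have h1 := H.le
  have h2 := H.le_two_mul
  rw [mem_region, mem_region, H.semilength_left, H.semilength_right]
  obtain ⟨x, y⟩ := s
  rcases lt_trichotomy x (p + 1) with hx | rfl | hx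
  · rw [collapse_of_le (by omega)] at h ⊢
    have h3 := height_le_sub μ' (k := x) (by rw [H.semilength_left]; omega)
    rw [H.semilength_left] at h3
    simp only [Int.odd_iff] at h ⊢
    omega
  · rw [collapse_apex] at h ⊢
    simp only [Int.odd_iff] at h ⊢
    push_cast
    omega
  · obtain ⟨z, rfl⟩ := Nat.exists_eq_add_of_le' (show 2 ≤ x by omega)
    rw [collapse_add_two (by omega)] at h ⊢
    simp only [Int.odd_iff] at h ⊢
    push_cast
    omega

lemma not_side (H : IsPeakInsertion n p μ' μ) {s : Box} (hs : collapse p s ∈ region μ') :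
    ¬ ((n < s.1 ∧ s.1 ≤ p) ∧ s.2 = 2 * n + 1 - s.1) := by
  rintro ⟨⟨h1, h2⟩, h3⟩
  have h4 : collapse p s = s := if_pos h2
  rw [h4, mem_region, H.semilength_left] at hs
  omega

lemma sideTile_ne_widen (H : IsPeakInsertion n p μ' μ) {x : ℕ} (hx : n < x ∧ x ≤ p)
    {d : Finset Box} (hd : d ⊆ region μ') :
    sideTile n x ≠ widen p d := by
  intro h
  have h1 : ((x, 2 * n + 1 - x) : Box) ∈ widen p d := by
    rw [← h, mem_sideTile]; exact ⟨rfl, rfl⟩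
  exact H.not_side (hd (mem_widen.mp h1)) ⟨hx, rfl⟩

lemma isTilingSet_growTiling (H : IsPeakInsertion n p μ' μ) {P : Finset (Finset Box)}
    (hP : IsTilingSet μ' P) :
    IsTilingSet μ (growTiling n p P) := by
  have hcol : ∀ d ∈ P, ∀ s ∈ widen p d, collapse p s ∈ region μ' := fun d hd s hs =>
    hP.subset d hd (mem_widen.mp hs)
  refine ⟨fun d hd => ?_, fun d hd s hs => ?_, fun s hs => ?_, fun d hd t ht s hs hs' => ?_,
    fun d hd => ?_⟩
  · rcases mem_growTiling.mp hd with ⟨t, ht, rfl⟩ | ⟨x, -, rfl⟩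
    · exact (hP.tile t ht).widen p
    · exact isDyckTile_singleton _
  · rw [H.mem_region_iff]
    rcases mem_growTiling.mp hd with ⟨t, ht, rfl⟩ | ⟨x, hx, rfl⟩
    · exact Or.inl (hcol t ht s hs)
    · obtain ⟨h1, h2⟩ := mem_sideTile.mp hs
      exact Or.inr ⟨by rwa [h1], by rw [h1, h2]⟩
  · rcases (H.mem_region_iff s).mp hs with h | ⟨h1, h2⟩
    · obtain ⟨d, hd, hs⟩ := hP.cover _ h
      exact ⟨_, mem_growTiling.mpr (Or.inl ⟨d, hd, rfl⟩), mem_widen.mpr hs⟩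
    · exact ⟨_, mem_growTiling.mpr (Or.inr ⟨s.1, h1, rfl⟩), mem_sideTile.mpr ⟨rfl, h2⟩⟩
  · rcases mem_growTiling.mp hd with ⟨d', hd', rfl⟩ | ⟨x, hx, rfl⟩ <;>
      rcases mem_growTiling.mp ht with ⟨t', ht', rfl⟩ | ⟨z, hz, rfl⟩
    · rw [hP.eq_of_mem d' hd' t' ht' _ (mem_widen.mp hs) (mem_widen.mp hs')]
    · obtain ⟨h1, h2⟩ := mem_sideTile.mp hs'
      exact absurd ⟨by rwa [h1], by rw [h1, h2]⟩ (H.not_side (hcol d' hd' s hs))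
    · obtain ⟨h1, h2⟩ := mem_sideTile.mp hs
      exact absurd ⟨by rwa [h1], by rw [h1, h2]⟩ (H.not_side (hcol t' ht' s hs'))
    · rw [← (mem_sideTile.mp hs).1, ← (mem_sideTile.mp hs').1]
  · rcases mem_growTiling.mp hd with ⟨d', hd', rfl⟩ | ⟨x, hx, rfl⟩
    · rw [shiftDown_widen]
      rcases hP.inclusive d' hd' with h | ⟨t, ht, h⟩
      · refine Or.inl fun s hs => ?_
        have h1 := h _ (mem_widen.mp hs)
        have h2 := H.height_sub s
        omega
      · exact Or.inr ⟨_, mem_growTiling.mpr (Or.inl ⟨t, ht, rfl⟩), widen_subset_widen.mpr h⟩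
    · have h0 := H.le_two_mul
      have hsh : shiftDown (sideTile n x) = {((x, 2 * n - 1 - x) : Box)} := by
        ext s
        rw [mem_shiftDown, mem_sideTile, Finset.mem_singleton, Prod.ext_iff]
        simp only
        omega
      have hpar := height_parity μ'.toList (k := x) (by
        rw [← μ'.two_mul_semilength_eq_length, H.semilength_left]; omega)
      rw [hsh]
      by_cases hlt : JonesWenzl.height μ'.toList x < 2 * n - 1 - x
      · have hr : ((x, 2 * n - 1 - x) : Box) ∈ region μ' := by
          rw [mem_region, H.semilength_left]
          simp only [Int.odd_iff]
          omega
        obtain ⟨t, ht, hxt⟩ := hP.cover _ hr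
        refine Or.inr ⟨_, mem_growTiling.mpr (Or.inl ⟨t, ht, rfl⟩), ?_⟩
        rw [Finset.singleton_subset_iff, mem_widen, collapse_of_le hx.2]
        exact hxt
      · refine Or.inl fun s hs => ?_
        rw [Finset.mem_singleton] at hs
        subst hs
        rw [H.height, if_pos hx.2]
        rw [Int.even_iff] at hpar
        simp only
        omega

lemma growTiling_injOn (H : IsPeakInsertion n p μ' μ) :
    Set.InjOn (growTiling n p) (tilingSets μ' : Set (Finset (Finset Box))) := by
  have key : ∀ P ∈ tilingSets μ', ∀ Q ∈ tilingSets μ', growTiling n p P = growTiling n p Q →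
      P ⊆ Q := by
    intro P hP Q hQ h d hd
    have h1 : widen p d ∈ growTiling n p Q := by
      rw [← h]; exact mem_growTiling.mpr (Or.inl ⟨d, hd, rfl⟩)
    rcases mem_growTiling.mp h1 with ⟨t, ht, e⟩ | ⟨x, hx, e⟩
    · rwa [← widen_injective p e]
    · exact absurd e (H.sideTile_ne_widen hx ((mem_tilingSets.mp hP).subset d hd))
  intro P hP Q hQ h
  exact Finset.Subset.antisymm (key P hP Q hQ h) (key Q hQ P hP h.symm)

end IsPeakInsertion

/-! ### The peak of a tiling -/

namespace IsTilingSet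

variable {n p : ℕ} {μ : DyckWord} {P : Finset (Finset Box)}

/-- All tiles that meet the column after the run of single boxes have a peak there: the topmost one
since it is not a single box and cannot meet the run, and the ones below by cover-inclusiveness. -/
lemma mem_of_mem_apex (hP : IsTilingSet μ P) (hμ : μ.semilength = n + 1) (h1 : n ≤ p)
    (hrun : HasRun n p P) (m : ℕ) {t : Finset Box} (ht : t ∈ P)
    (hm : ((p + 1, 2 * n - p - 2 * m) : Box) ∈ t) :
    ((p, 2 * n - p - 2 * m - 1) : Box) ∈ t ∧ ((p + 2, 2 * n - p - 2 * m - 1) : Box) ∈ t := by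
  induction m generalizing t with
  | zero =>
    simp only [Nat.cast_zero, mul_zero, sub_zero] at hm ⊢
    obtain ⟨a, b, f, hab, hstep, hmin, hend, hd⟩ := isDyckTile_iff.mp (hP.tile t ht)
    obtain ⟨ha, hb, hf⟩ := (hd _).mp hm
    simp only at ha hb hf
    have hmem : ∀ x, a ≤ x → x ≤ b → ((x, f x) : Box) ∈ t := fun x k1 k2 =>
      (hd _).mpr ⟨k1, k2, rfl⟩
    have hreg : ∀ x, a ≤ x → x ≤ b → f x < x ∧ x + f x < 2 * n + 2 := by
      intro x k1 k2
      have h3 := mem_region.mp (hP.subset t ht (hmem x k1 k2))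
      rw [hμ] at h3
      push_cast at h3
      omega
    have hne : a ≠ b := by
      rintro rfl
      apply hrun.2
      convert ht
      ext s
      rw [mem_sideTile, hd]
      constructor
      · rintro ⟨k1, k2⟩
        rw [k1]
        refine ⟨ha, hb, ?_⟩
        rw [k2, ← hf]; push_cast; ring
      · rintro ⟨k1, k2, k3⟩
        have k4 : s.1 = p + 1 := by omega
        refine ⟨k4, ?_⟩
        rw [k3, k4, ← hf]; push_cast; ring
    have hap : a ≤ p := by
      by_contra hcon
      have ea : a = p + 1 := by omega
      have k1 := hreg (p + 2) (by omega) (by omega)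
      have k2 := hmin (p + 2) (by omega) (by omega)
      have k3 := hstep (p + 1) (by omega) (by omega)
      rw [ea] at k2
      push_cast at k1
      simp only [show p + 1 + 1 = p + 2 from rfl] at k3
      omega
    have hfp : f p = 2 * n - p - 1 := by
      rcases hstep p hap (by omega) with k | k
      · omega
      · exfalso
        rcases h1.eq_or_lt with rfl | hlt
        · have := hreg n hap (by omega)
          omega
        · have k1 := hrun.1 p hlt le_rfl
          have k2 := hP.eq_of_mem t ht _ k1 _ (hmem p hap (by omega))
            (mem_sideTile.mpr ⟨rfl, by simp only; omega⟩)
          rw [k2, mem_sideTile] at hm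
          simp at hm
    have hbp : p + 2 ≤ b := by
      by_contra hcon
      have eb : b = p + 1 := by omega
      have k1 := hmin p hap (by omega)
      rw [eb] at hend
      omega
    have hfp2 : f (p + 2) = 2 * n - p - 1 := by
      have k1 := hreg (p + 2) (by omega) hbp
      have k3 := hstep (p + 1) (by omega) (by omega)
      push_cast at k1
      simp only [show p + 1 + 1 = p + 2 from rfl] at k3
      omega
    exact ⟨(hd _).mpr ⟨hap, by simp only; omega, hfp.symm⟩,
      (hd _).mpr ⟨by simp only; omega, hbp, hfp2.symm⟩⟩
  | succ m ih =>
    have hr := mem_region.mp (hP.subset t ht hm)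
    rw [hμ, Int.odd_iff] at hr
    push_cast at hr hm ⊢
    have hr' : ((p + 1, 2 * n - p - 2 * m) : Box) ∈ region μ := by
      rw [mem_region, hμ, Int.odd_iff]
      push_cast
      omega
    obtain ⟨t', ht', hmt'⟩ := hP.cover _ hr'
    obtain ⟨k1, k2⟩ := ih ht' hmt'
    have k3 : ((p + 1, 2 * n - p - 2 * (m + 1)) : Box) ∈ shiftDown t' := by
      rw [mem_shiftDown]
      convert hmt' using 2
      ring
    rcases hP.inclusive t' ht' with h | ⟨u, hu, h⟩
    · have := h _ k3
      simp only at this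
      omega
    · have e : u = t := hP.eq_of_mem u hu t ht _ (h k3) hm
      subst e
      constructor
      · apply h
        rw [mem_shiftDown]
        convert k1 using 2
        ring
      · apply h
        rw [mem_shiftDown]
        convert k2 using 2
        ring

/-- The path of a tiling has a peak after its run of single boxes. -/
lemma height_of_hasRun (hP : IsTilingSet μ P) (hμ : μ.semilength = n + 1) (h1 : n ≤ p)
    (h2 : p ≤ 2 * n) (hrun : HasRun n p P) :
    height μ.toList p + 1 = height μ.toList (p + 1) ∧
    height μ.toList (p + 2) + 1 = height μ.toList (p + 1) := by
  have hlen : μ.toList.length = 2 * (n + 1) := by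
    rw [← μ.two_mul_semilength_eq_length, hμ]
  have s1 := height_succ_or μ.toList (k := p) (by omega)
  have s2 := height_succ_or μ.toList (k := p + 1) (by omega)
  have b1 := height_le_sub μ (k := p + 1) (by omega)
  have b2 := height_le_sub μ (k := p + 2) (by omega)
  have hpar := height_parity μ.toList (k := p + 1) (by omega)
  simp only [show p + 1 + 1 = p + 2 from rfl] at s2
  rw [hμ] at b1 b2
  push_cast at b1 b2 hpar
  rw [Int.even_iff] at hpar
  by_cases htop : height μ.toList (p + 1) = 2 * n + 1 - p
  · refine ⟨?_, by omega⟩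
    rcases h1.eq_or_lt with rfl | hlt
    · have := height_le μ.toList n
      omega
    · have k1 := hP.subset _ (hrun.1 p hlt le_rfl)
        (mem_sideTile (s := (p, 2 * n + 1 - p)).mpr ⟨rfl, rfl⟩)
      have k2 := (mem_region.mp k1).2.1
      simp only at k2
      omega
  · -- the lowest box above the apex belongs to a tile with a peak
    obtain ⟨m, hm⟩ : ∃ m : ℕ, 2 * (n : ℤ) - p - 2 * m = height μ.toList (p + 1) + 1 :=
      ⟨((2 * (n : ℤ) - p - 1 - height μ.toList (p + 1)) / 2).toNat, by omega⟩
    have hr : ((p + 1, 2 * n - p - 2 * m) : Box) ∈ region μ := by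
      rw [mem_region, hμ, Int.odd_iff, hm]
      push_cast
      omega
    obtain ⟨t, ht, hmt⟩ := hP.cover _ hr
    obtain ⟨k1, k2⟩ := hP.mem_of_mem_apex hμ h1 hrun m ht hmt
    have k3 := (mem_region.mp (hP.subset t ht k1)).2.1
    have k4 := (mem_region.mp (hP.subset t ht k2)).2.1
    simp only at k3 k4
    omega

end IsTilingSet

/-! ### Removal of a peak and of a strip of single boxes -/

namespace IsPeakInsertion

variable {n p : ℕ} {μ' μ : DyckWord} {P : Finset (Finset Box)}

lemma mem_strip_of_side (hP : IsTilingSet μ P) (hrun : HasRun n p P) {d : Finset Box} (hd : d ∈ P)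
    {s : Box} (hs : s ∈ d) (h : (n < s.1 ∧ s.1 ≤ p) ∧ s.2 = 2 * n + 1 - s.1) : d ∈ strip n p :=
  mem_strip.mpr ⟨s.1, h.1, hP.eq_of_mem _ (hrun.1 _ h.1.1 h.1.2) d hd s
    (mem_sideTile.mpr ⟨rfl, h.2⟩) hs⟩

/-- A tile outside the strip is a widening: it meets the columns `p`, `p + 1`, `p + 2` in a
sequence of peaks. -/
lemma widen_image_collapse (H : IsPeakInsertion n p μ' μ) (hP : IsTilingSet μ P)
    (hrun : HasRun n p P) {d : Finset Box} (hd : d ∈ P) (hds : d ∉ strip n p) :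
    widen p (d.image (collapse p)) = d := by
  have hapex : ∀ t ∈ P, ∀ y : ℤ, ((p + 1, y + 1) : Box) ∈ t →
      ((p, y) : Box) ∈ t ∧ ((p + 2, y) : Box) ∈ t := by
    intro t ht y hy
    have hr := mem_region.mp (hP.subset t ht hy)
    rw [H.semilength_right, Int.odd_iff] at hr
    push_cast at hr
    obtain ⟨m, hm⟩ : ∃ m : ℕ, y + 1 = 2 * n - p - 2 * m :=
      ⟨((2 * n - p - y - 1) / 2).toNat, by omega⟩
    rw [hm] at hy
    have := hP.mem_of_mem_apex H.semilength_right H.le hrun m ht hy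
    rwa [← hm, add_sub_cancel_right] at this
  have hcol : ∀ s ∈ d, collapse p s ∈ region μ' := fun s hs =>
    ((H.mem_region_iff s).mp (hP.subset d hd hs)).resolve_right fun h =>
      hds (mem_strip_of_side hP hrun hd hs h)
  have hback : ∀ y : ℤ, ((p, y) : Box) ∈ region μ' →
      ((p, y) : Box) ∈ d ∨ ((p + 2, y) : Box) ∈ d → ((p + 1, y + 1) : Box) ∈ d := by
    intro y hy hyd
    have hr : ((p + 1, y + 1) : Box) ∈ region μ := by
      rw [H.mem_region_iff, collapse_apex, add_sub_cancel_right]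
      exact Or.inl hy
    obtain ⟨t, ht, hyt⟩ := hP.cover _ hr
    obtain ⟨k1, k2⟩ := hapex t ht y hyt
    have e : d = t := by
      rcases hyd with h | h
      · exact hP.eq_of_mem d hd t ht _ h k1
      · exact hP.eq_of_mem d hd t ht _ h k2
    rwa [e]
  have hmid : ∀ y : ℤ, ((p + 1, y) : Box) ∈ d ↔ ((p, y - 1) : Box) ∈ d := by
    intro y
    constructor
    · intro h
      exact (hapex d hd (y - 1) (by rwa [sub_add_cancel])).1
    · intro h
      have h0 := hcol _ h
      rw [collapse_of_le le_rfl] at h0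
      have := hback (y - 1) h0 (Or.inl h)
      rwa [sub_add_cancel] at this
  have hright : ∀ y : ℤ, ((p + 2, y) : Box) ∈ d ↔ ((p, y) : Box) ∈ d := by
    intro y
    constructor
    · intro h
      have h0 := hcol _ h
      rw [collapse_add_two le_rfl] at h0
      exact (hapex d hd y (hback y h0 (Or.inr h))).1
    · intro h
      have h0 := hcol _ h
      rw [collapse_of_le le_rfl] at h0
      exact (hapex d hd y (hback y h0 (Or.inl h))).2
  -- membership in `d` can be read off at a representative of the fibre of `collapse p`
  have hrep : ∀ s : Box, s ∈ d ↔ (if (collapse p s).1 ≤ p then collapse p s else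
      ((collapse p s).1 + 2, (collapse p s).2)) ∈ d := by
    rintro ⟨x, y⟩
    rcases lt_trichotomy x (p + 1) with hx | rfl | hx
    · rw [collapse_of_le (by omega), if_pos (by simp only; omega)]
    · rw [collapse_apex, if_pos le_rfl, hmid]
    · obtain ⟨z, rfl⟩ := Nat.exists_eq_add_of_le' (show 2 ≤ x by omega)
      rw [collapse_add_two (by omega)]
      rcases (show p ≤ z by omega).eq_or_lt with rfl | hz
      · rw [if_pos le_rfl, hright]
      · rw [if_neg (by simp only; omega)]
  ext s
  rw [mem_widen, Finset.mem_image]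
  constructor
  · rintro ⟨r, hr, e⟩
    rw [hrep, ← e, ← hrep]
    exact hr
  · intro hs
    exact ⟨s, hs, rfl⟩

/-- The removal of the peak and of the strip: the tiles of the smaller tiling are those whose
widenings belong to the given one. -/
lemma exists_growTiling_eq (H : IsPeakInsertion n p μ' μ) (hP : IsTilingSet μ P)
    (hrun : HasRun n p P) : ∃ Q, IsTilingSet μ' Q ∧ growTiling n p Q = P := by
  classical
  have hcol : ∀ d ∈ P, d ∉ strip n p → ∃ t ⊆ region μ', widen p t = d := by
    intro d hd hds
    refine ⟨_, fun s hs => ?_, H.widen_image_collapse hP hrun hd hds⟩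
    obtain ⟨r, hr, rfl⟩ := Finset.mem_image.mp hs
    exact ((H.mem_region_iff r).mp (hP.subset d hd hr)).resolve_right fun h =>
      hds (mem_strip_of_side hP hrun hd hr h)
  have hstrip : ∀ d ∈ strip n p, ∀ s ∈ d, collapse p s ∉ region μ' := by
    intro d hd s hs hr
    obtain ⟨x, hx, rfl⟩ := mem_strip.mp hd
    obtain ⟨k1, k2⟩ := mem_sideTile.mp hs
    exact H.not_side hr ⟨by rwa [k1], by rw [k1, k2]⟩
  set Q := (region μ').powerset.filter fun d => widen p d ∈ P with hQ
  have memQ : ∀ d, d ∈ Q ↔ d ⊆ region μ' ∧ widen p d ∈ P := fun d => by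
    rw [hQ, Finset.mem_filter, Finset.mem_powerset]
  refine ⟨Q, ⟨fun d hd => ?_, fun d hd => ((memQ d).mp hd).1, fun s hs => ?_,
    fun d hd t ht s hs hs' => ?_, fun d hd => ?_⟩, ?_⟩
  · exact isDyckTile_of_widen (hP.tile _ ((memQ d).mp hd).2)
  · obtain ⟨r, rfl, -⟩ := collapse_surjective p s
    obtain ⟨d, hd, hr⟩ := hP.cover r ((H.mem_region_iff r).mpr (Or.inl hs))
    obtain ⟨t, ht, rfl⟩ := hcol d hd fun h => hstrip d h r hr hs
    exact ⟨t, (memQ t).mpr ⟨ht, hd⟩, mem_widen.mp hr⟩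
  · obtain ⟨r, rfl, -⟩ := collapse_surjective p s
    exact widen_injective p (hP.eq_of_mem _ ((memQ d).mp hd).2 _ ((memQ t).mp ht).2 r
      (mem_widen.mpr hs) (mem_widen.mpr hs'))
  · obtain ⟨hd1, hd2⟩ := (memQ d).mp hd
    have hi := hP.inclusive _ hd2
    rw [shiftDown_widen] at hi
    rcases hi with h | ⟨t, ht, h⟩
    · refine Or.inl fun s hs => ?_
      obtain ⟨r, rfl, -⟩ := collapse_surjective p s
      have k1 := h r (mem_widen.mpr hs)
      have k2 := H.height_sub r
      omega
    · -- a single box of the strip is not covered from above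
      have hts : t ∉ strip n p := by
        intro hts
        obtain ⟨x, hx, rfl⟩ := mem_strip.mp hts
        obtain ⟨s, hs⟩ := (hP.tile _ hd2).nonempty
        have hs' : ((s.1, s.2 - 2) : Box) ∈ widen p (shiftDown d) := by
          rw [← shiftDown_widen, mem_shiftDown]
          simpa using hs
        obtain ⟨k1, k2⟩ := mem_sideTile.mp (h hs')
        have k3 := (mem_region.mp (hP.subset _ hd2 hs)).2.2.2
        rw [H.semilength_right] at k3
        push_cast at k3
        simp only at k1 k2
        omega
      obtain ⟨u, hu, rfl⟩ := hcol t ht hts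
      exact Or.inr ⟨u, (memQ u).mpr ⟨hu, ht⟩, widen_subset_widen.mp h⟩
  · ext d
    rw [mem_growTiling, ← mem_strip]
    constructor
    · rintro (⟨t, ht, rfl⟩ | h)
      · exact ((memQ t).mp ht).2
      · obtain ⟨x, hx, rfl⟩ := mem_strip.mp h
        exact hrun.1 x hx.1 hx.2
    · intro hd
      by_cases h : d ∈ strip n p
      · exact Or.inr h
      · obtain ⟨t, ht, rfl⟩ := hcol d hd h
        exact Or.inl ⟨t, (memQ t).mpr ⟨ht, hd⟩, rfl⟩

/-! ### The recursion of the generating function -/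

/-- The product of the weights `[h] / [h + 1]` of the boxes of the strip telescopes, as their heights
are consecutive. -/
lemma prod_tileWeight_strip (h1 : n ≤ p) (h2 : p ≤ 2 * n) :
    ∏ d ∈ strip n p, tileWeight d =
      qInt (2 * n + 1 - p) / qInt ((n + 1 : ℕ) : ℤ) := by
  rw [strip, Finset.prod_image fun x _ y _ h => sideTile_injective n h]
  induction p, h1 using Nat.le_induction with
  | base =>
    rw [Finset.Ioc_self, Finset.prod_empty,
      show 2 * (n : ℤ) + 1 - n = ((n + 1 : ℕ) : ℤ) by push_cast; ring]
    exact (div_self (qInt_natCast_ne_zero (by omega))).symm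
  | succ p hp ih =>
    rw [← Finset.insert_Ioc_right_eq_Ioc_add_one hp, Finset.prod_insert (by simp), ih (by omega),
      tileWeight, sideTile, tileHeight_singleton]
    have e : 2 * (n : ℤ) + 1 - (p + 1 : ℕ) + 1 = 2 * n + 1 - p := by push_cast; ring
    rw [e, div_mul_div_cancel₀ (qInt_pos_ne_zero (by omega))]

lemma prod_tileWeight_growTiling (H : IsPeakInsertion n p μ' μ) (hP : IsTilingSet μ' P) :
    ∏ d ∈ growTiling n p P, tileWeight d =
      qInt (2 * n + 1 - p) / qInt ((n + 1 : ℕ) : ℤ) * ∏ d ∈ P, tileWeight d := by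
  rw [growTiling, Finset.prod_union, prod_tileWeight_strip H.le H.le_two_mul, mul_comm,
    Finset.prod_image fun x _ y _ h => widen_injective p h]
  · congr 1
    refine Finset.prod_congr rfl fun d hd => ?_
    rw [tileWeight, tileWeight, tileHeight_widen p (hP.tile d hd)]
  · refine Finset.disjoint_left.mpr fun d hd hd' => ?_
    obtain ⟨t, ht, rfl⟩ := Finset.mem_image.mp hd
    obtain ⟨x, hx, e⟩ := mem_strip.mp hd'
    exact H.sideTile_ne_widen hx (hP.subset t ht) e

open Classical in
/-- The tilings above the large path with a given run correspond to the tilings above the small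
path. -/
lemma sum_hasRun (H : IsPeakInsertion n p μ' μ) :
    ∑ P ∈ (tilingSets μ).filter (HasRun n p), ∏ d ∈ P, tileWeight d =
      qInt (2 * n + 1 - p) / qInt ((n + 1 : ℕ) : ℤ) * Z μ' := by
  rw [Z_eq_sum, Finset.mul_sum]
  symm
  refine Finset.sum_nbij (growTiling n p) (fun Q hQ => ?_) H.growTiling_injOn (fun P hP => ?_)
    (fun Q hQ => ?_)
  · rw [Finset.mem_filter, mem_tilingSets]
    exact ⟨H.isTilingSet_growTiling (mem_tilingSets.mp hQ), hasRun_growTiling n p Q⟩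
  · rw [Finset.mem_coe, Finset.mem_filter, mem_tilingSets] at hP
    obtain ⟨Q, hQ, e⟩ := H.exists_growTiling_eq hP.1 hP.2
    exact ⟨Q, Finset.mem_coe.mpr (mem_tilingSets.mpr hQ), e⟩
  · exact (H.prod_tileWeight_growTiling (mem_tilingSets.mp hQ)).symm

end IsPeakInsertion

lemma HasRun.unique {n p p' : ℕ} {P : Finset (Finset Box)} (h1 : n ≤ p) (h1' : n ≤ p')
    (h : HasRun n p P) (h' : HasRun n p' P) : p = p' := by
  rcases lt_trichotomy p p' with hlt | rfl | hlt
  · exact absurd (h'.1 (p + 1) (by omega) (by omega)) h.2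
  · rfl
  · exact absurd (h.1 (p' + 1) (by omega) (by omega)) h'.2

lemma IsTilingSet.exists_hasRun {n : ℕ} {μ : DyckWord} {P : Finset (Finset Box)}
    (hP : IsTilingSet μ P) : ∃ p, n ≤ p ∧ p ≤ 2 * n ∧ HasRun n p P := by
  classical
  have hlast : sideTile n (n + n + 1) ∉ P := by
    intro h
    have h1 := mem_region.mp (hP.subset _ h
      (mem_sideTile (s := (n + n + 1, 0)).mpr ⟨rfl, by push_cast; ring⟩))
    have h2 := height_nonneg μ (n + n + 1)
    simp only at h1
    omega
  have hex : ∃ k, sideTile n (n + k + 1) ∉ P := ⟨n, hlast⟩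
  refine ⟨n + Nat.find hex, by omega, ?_, fun x h1 h2 => ?_, Nat.find_spec hex⟩
  · have := Nat.find_min' hex hlast
    omega
  · have := Nat.find_min hex (m := x - n - 1) (by omega)
    rw [not_not, show n + (x - n - 1) + 1 = x by omega] at this
    exact this

open Classical in
/-- The tilings are sorted by the length of their runs of single boxes. -/
lemma Z_eq_sum_hasRun (n : ℕ) (μ : DyckWord) : Z μ = ∑ p ∈ Finset.Icc n (2 * n),
    ∑ P ∈ (tilingSets μ).filter (HasRun n p), ∏ d ∈ P, tileWeight d := by
  simp only [Finset.sum_filter]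
  rw [Z_eq_sum, Finset.sum_comm]
  refine Finset.sum_congr rfl fun P hP => ?_
  obtain ⟨p, h1, h2, hrun⟩ := (mem_tilingSets.mp hP).exists_hasRun (n := n)
  rw [Finset.sum_eq_single_of_mem p (Finset.mem_Icc.mpr ⟨h1, h2⟩), if_pos hrun]
  intro p' hp' hne
  exact if_neg fun h => hne (h.unique (Finset.mem_Icc.mp hp').1 h1 hrun)

lemma Z_of_semilength_eq_zero {μ : DyckWord} (h : μ.semilength = 0) : Z μ = 1 := by
  have hr : region μ = ∅ := by
    ext s
    have := height_nonneg μ s.1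
    simp only [mem_region, h, Finset.notMem_empty, iff_false]
    omega
  have : tilingSets μ = {∅} := by
    ext P
    rw [mem_tilingSets, Finset.mem_singleton]
    constructor
    · intro hP
      by_contra hne
      obtain ⟨d, hd⟩ := Finset.nonempty_iff_ne_empty.mpr hne
      obtain ⟨s, hs⟩ := (hP.tile d hd).nonempty
      have := hP.subset d hd hs
      simp [hr] at this
    · rintro rfl
      constructor <;> simp [hr]
  rw [Z_eq_sum, this, Finset.sum_singleton, Finset.prod_empty]

/-! ### Insertion of arcs and peaks of the Dyck path -/

section diagram

variable {n : ℕ}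

lemma height_dyckPath_succ (D : TLDiagram n) {k : ℕ} (hk : k < 2 * n) :
    height (dyckPath D).toList (k + 1) =
      height (dyckPath D).toList k + if k < pos D k then 1 else -1 := by
  have hlen : k < (diagramSteps D).length := by simpa [diagramSteps] using hk
  have h1 : (diagramSteps D)[k] = stepAt D ⟨k, hk⟩ := by simp [diagramSteps]
  have h2 : stepAt D ⟨k, hk⟩ = DyckStep.U ↔ k < pos D k := by
    rw [stepAt_eq_U, Fin.lt_def, ← pos_val]
  rw [show (dyckPath D).toList = diagramSteps D from rfl, height_succ _ hlen, h1]
  simp only [h2]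

lemma isPeakInsertion_ins {j : ℕ} (hj : j ≤ n) (D : TLDiagram n) :
    IsPeakInsertion n (2 * n - j) (dyckPath D) (dyckPath (ins j D)) := by
  refine ⟨semilength_dyckPath D, semilength_dyckPath _, by omega, by omega, fun x => ?_⟩
  obtain ⟨p, hp⟩ : ∃ p, p = 2 * n - j := ⟨_, rfl⟩
  have hpos : ∀ k, pos (ins j D) k = insertArc p (pos D) k := fun k => by rw [pos_ins, hp]
  have hgap : ∀ k, gap p k < pos (ins j D) (gap p k) ↔ k < pos D k := fun k => by
    rw [hpos, insertArc_gap, gap_lt_gap]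
  rw [← hp]
  by_cases hx : x ≤ 2 * (n + 1)
  · induction x with
    | zero => simp
    | succ x ih =>
      rw [height_dyckPath_succ _ (by omega), ih (by omega)]
      rcases lt_trichotomy x p with h | rfl | h
      · have h1 := hgap x
        rw [show gap p x = x from if_pos h] at h1
        rw [if_pos (show x ≤ p by omega), if_pos (show x + 1 ≤ p by omega),
          height_dyckPath_succ D (by omega)]
        simp only [h1]
      · rw [hpos, insertArc_self, if_pos le_rfl, if_pos (by omega), if_neg (by omega), if_pos rfl]
      · rcases (show p + 1 ≤ x by omega).eq_or_lt with rfl | h'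
        · rw [hpos, insertArc_succ, if_neg (by omega), if_pos rfl, if_neg (by omega),
            if_neg (by omega), if_neg (by omega)]
          simp
        · obtain ⟨z, rfl⟩ := Nat.exists_eq_add_of_le' (show 2 ≤ x by omega)
          have h1 := hgap z
          rw [show gap p z = z + 2 from if_neg (by omega)] at h1
          rw [if_neg (show ¬ z + 2 ≤ p by omega), if_neg (show ¬ z + 2 = p + 1 by omega),
            if_neg (show ¬ z + 2 + 1 ≤ p by omega), if_neg (show ¬ z + 2 + 1 = p + 1 by omega),
            show z + 2 + 1 - 2 = z + 1 by omega, Nat.add_sub_cancel,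
            height_dyckPath_succ D (by omega)]
          simp only [h1]
  · rw [height_of_length_le _ (by rw [semilength_dyckPath]; omega), if_neg (by omega),
      if_neg (by omega), height_of_length_le _ (by rw [semilength_dyckPath]; omega)]

/-- A peak of the Dyck path of a diagram in the right half of the path comes from an inserted
arc. -/
lemma exists_ins_eq_of_height (D : TLDiagram (n + 1)) {j : ℕ} (hj : j ≤ n)
    (h1 : height (dyckPath D).toList (2 * n - j) + 1 = height (dyckPath D).toList (2 * n - j + 1))
    (h2 : height (dyckPath D).toList (2 * n - j + 2) + 1 =
      height (dyckPath D).toList (2 * n - j + 1)) : ∃ D' : TLDiagram n, ins j D' = D := by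
  apply exists_ins_eq D (by omega)
  have e1 := height_dyckPath_succ D (show 2 * n - j < 2 * (n + 1) by omega)
  have e2 := height_dyckPath_succ D (show 2 * n - j + 1 < 2 * (n + 1) by omega)
  have e3 := pos_ne D (show 2 * n - j + 1 < 2 * (n + 1) by omega)
  apply pos_eq_succ_of_lt
  · by_contra h
    rw [if_neg h] at e1
    omega
  · by_contra h
    rw [if_pos (by omega), show 2 * n - j + 1 + 1 = 2 * n - j + 2 from rfl] at e2
    omega

end diagram

/-- The coefficients of `zeta` are the generating functions of Dyck tilings: both satisfy the same
recursion over the small arcs in the right half of the folded diagram. -/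
lemma zeta_apply {n : ℕ} (D : TLDiagram n) : zeta n D = Z (dyckPath D) := by
  classical
  induction n with
  | zero =>
    rw [Z_of_semilength_eq_zero (semilength_dyckPath D), D.eq_of_zero (idDiagram 0),
      zeta_idDiagram]
  | succ n ih =>
    rw [zeta_succ_apply, Z_eq_sum_hasRun n]
    refine Finset.sum_nbij' (fun j => 2 * n - j) (fun p => 2 * n - p) ?_ ?_ ?_ ?_ ?_
    · intro j hj
      rw [Finset.mem_range] at hj
      rw [Finset.mem_Icc]
      omega
    · intro p hp
      rw [Finset.mem_Icc] at hp
      rw [Finset.mem_range]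
      omega
    · intro j hj
      rw [Finset.mem_range] at hj
      omega
    · intro p hp
      rw [Finset.mem_Icc] at hp
      omega
    · intro j hj
      rw [Finset.mem_range] at hj
      by_cases h : ∃ D' : TLDiagram n, ins j D' = D
      · obtain ⟨D', rfl⟩ := h
        rw [insLin_apply, ih, (isPeakInsertion_ins (by omega) D').sum_hasRun]
        congr 3
        omega
      · rw [insLin_apply_of_notMem _ _ _ (not_exists.mp h), mul_zero, eq_comm]
        rw [Finset.filter_eq_empty_iff.mpr, Finset.sum_empty]
        intro P hP hrun
        obtain ⟨h1, h2⟩ := (mem_tilingSets.mp hP).height_of_hasRun (semilength_dyckPath D)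
          (by omega) (by omega) hrun
        exact h (exists_ins_eq_of_height D (by omega) h1 h2)

end

end JonesWenzl

theorem mainTheorem1 (n : ℕ) :
    (∃! P : JonesWenzl.TLAlgebra n, JonesWenzl.IsJonesWenzl P) ∧
    ∀ P : JonesWenzl.TLAlgebra n, JonesWenzl.IsJonesWenzl P →
      ∀ D : JonesWenzl.TLDiagram n,
        JonesWenzl.coeff D P = JonesWenzl.Z (JonesWenzl.dyckPath D) := by
  obtain ⟨P, hP⟩ := JonesWenzl.exists_isJonesWenzl n
  refine ⟨⟨P, hP, fun Q hQ => JonesWenzl.IsJonesWenzl.unique hQ hP⟩, fun Q hQ D => ?_⟩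
  rw [JonesWenzl.coeff, hQ.toDiagrams_eq, JonesWenzl.zeta_apply]
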